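/- Let \(v=-x\,\partial_y+\text{h.o.t.}\) be a planar real formal vector field, where h.o.t. denotes terms of degree at least two in \((x,y)\). Suppose that an invertible formal change of state variables \(\varphi_0\) (fixing the origin) brings \(v\) into the classical normal form \[ -x\,\partial_y+\sum_{k\ge1}a_k\,y^{k+1}\partial_x+\sum_{k\ge1}b_k\,y^k\,(x\,\partial_x+y\,\partial_y), \] that not all \(a_k\) and not all \(b_k\) vanish, and that, with \(s=\min\{k: b_k\neq0\}\) and \(\rho=\min\{k: a_k\neq0\}\), we have \(2s<\rho\) (the generalized saddle-node case). Then there are an invertible formal change of state variables fixing the origin, \((x,y)=\varphi(X,Y)\), and a time rescaling \(dt=T(X,Y)\,d\tau\) with a formal power series \(T\), \(T(0,0)\ne0\), that transform \(\dot{(x,y)}=v(x,y)\) into a system which (writing again \(x,y\) for the new variables) has the form \[ \dot x=xy^s+\sum_{i>2s}\alpha_i y^{i+1},\qquad \dot y=-x+y^{s+1}, \] with real \(\alpha_i\) (put \(\alpha_i=0\) for \(i\le 2s\)) such that \(\alpha_{k(s+1)+2s}=0\) for every natural number \(k\neq s\). If \(\varphi_0\) is near-identity and \(b_s=1\), then \(\varphi\)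 can be chosen near-identity (identity plus terms of degree at least two) and \(T(0,0)=1\). Moreover, if the \(\alpha_i\) are not all zero and \(r_1=\min\{i:\alpha_i\neq0\}\), so that \(\dot x=xy^s+\alpha_{r_1}y^{r_1+1}+\sum_{i>r_1}\alpha_iy^{i+1}\), then \(\alpha_{r_1+s^2+s}=0\) and \(r_1\neq k(s+1)+2s\) for all natural \(k\ne s\). If in addition \(r_1=s(s+1)+2s\), some \(\alpha_i\) with \(i>r_1\) is nonzero, and \(r_2=\min\{i>r_1:\alpha_i\neq0\}\) satisfies \(r_2<2s^2+4s\), then \(\alpha_{s+r_2+s^2}=0\). -/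

import Mathlib

open MvPowerSeries

noncomputable section

/-- Real formal power series in the two variables `x` and `y`. -/
abbrev Series : Type := MvPowerSeries (Fin 2) ℝ

/-- The coordinate `x`. -/
abbrev xVar : Series := X 0

/-- The coordinate `y`. -/
abbrev yVar : Series := X 1

/-- A planar formal vector field `v 0 ∂/∂x + v 1 ∂/∂y`, that is, the formal differential system
`x' = v 0 (x, y)`, `y' = v 1 (x, y)`. -/
abbrev FormalVectorField : Type := Fin 2 → Series

/-- The matrix of the linear part at the origin of a pair of power series. -/
def linearPart (f : Fin 2 → Series) : Matrix (Fin 2) (Fin 2) ℝ :=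
  Matrix.of fun i j => coeff (Finsupp.single j 1) (f i)

/-- `v = -x ∂/∂y + higher order terms`. -/
def IsBogdanovTakens (v : FormalVectorField) : Prop :=
  (∀ i, constantCoeff (v i) = 0) ∧ linearPart v = !![0, 0; -1, 0]

/-- An invertible formal change of state variables `(x, y) = φ (X, Y)` fixing the origin. -/
def IsStateChange (φ : Fin 2 → Series) : Prop :=
  (∀ i, constantCoeff (φ i) = 0) ∧ (linearPart φ).det ≠ 0

/-- A near-identity change: the identity plus terms of degree at least two. -/
def IsNearIdentity (φ : Fin 2 → Series) : Prop :=
  (∀ i, constantCoeff (φ i) = 0) ∧ linearPart φ = 1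

/-- The change of state variables `(x, y) = φ (X, Y)` together with the time rescaling
`dt = T (X, Y) dτ` turns the system `d(x, y)/dt = v (x, y)` into `d(X, Y)/dτ = w (X, Y)`:
`Dφ · w = T · (v ∘ φ)`. -/
def Transforms (φ : Fin 2 → Series) (T : Series) (v w : FormalVectorField) : Prop :=
  ∀ i, ∑ j, pderiv ℝ j (φ i) * w j = T * subst φ (v i)

/-- The power series `∑ k, c k * y ^ k`. -/
def seriesInY (c : ℕ → ℝ) : Series :=
  fun n => if n 0 = 0 then c (n 1) else 0

/-- `-x ∂/∂y + ∑ k, a k y^(k+1) ∂/∂x + ∑ k, b k y^k (x ∂/∂x + y ∂/∂y)`. -/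
def classicalForm (a b : ℕ → ℝ) : FormalVectorField :=
  ![yVar * seriesInY a + xVar * seriesInY b, -xVar + yVar * seriesInY b]

/-- `φ` is a change of state variables (without time rescaling) that brings `v` into the classical
normal form with coefficients `a k`, `b k`, `k ≥ 1`. -/
def IsClassicalReduction (v : FormalVectorField) (φ : Fin 2 → Series) (a b : ℕ → ℝ) : Prop :=
  IsStateChange φ ∧ a 0 = 0 ∧ b 0 = 0 ∧ Transforms φ 1 v (classicalForm a b)

/-- The system `x' = x y^s + ∑ i, α i y^(i+1)`, `y' = -x + y^(s+1)`. -/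
def orbitalForm (s : ℕ) (α : ℕ → ℝ) : FormalVectorField :=
  ![xVar * yVar ^ s + yVar * seriesInY α, -xVar + yVar ^ (s + 1)]

end

/-! Give x weight s + 1 and y weight 1, and write E = x ∂/∂x + y ∂/∂y. Since 2s < ρ, a scaling of x
and of time turns the classical form into V₀ = y^s E - x ∂/∂y plus terms of higher weighted degree.
An infinitesimal change of state and time of degree k adds g V₀ + [Y, V₀], so the question is what
these fields leave uncovered.

In each degree k ≥ 1 the cokernel is spanned by y^(2s+k+1) ∂/∂x, which is congruent to a nonzero
multiple of y^(k+s) E (`exists_add_smul_xField_mem`, `exists_xField_sub_mem_tangent`). When k =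
(s+1)K with K ≠ s, a chain of relations ending at (K-s) x^K y^s E shows that this generator is
itself tangent (`xField_mem_tangent`), so its coefficient can be removed. Solving degree by degree
and passing to the limit gives the orbital form (`exists_transforms_orbitalForm`).

The exceptional K = s reflects a symmetry: x^s E commutes with V₀. Its flow fixes V₀ exactly and
acts on the remaining terms by a bracket (`exists_flow`). Modulo tangent fields, the bracket of x^s
E with y^(r+1) ∂/∂x, r > 2s, is a nonzero multiple of y^(r+s(s+1)+1) ∂/∂x
(`exists_bracket_eulerField_xField`). The one free parameter of the flow therefore removes the
coefficient of index r₁ + s(s+1). If r₁ = s(s+1) + 2s, that coefficient already vanishes (K = 2s),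
and the parameter is spent on r₂ instead. -/

namespace BogdanovTakens

/-! ### The filtration of power series by weighted order -/

/-- The weight of the monomial `x ^ d 0 * y ^ d 1` when `x` has weight `s + 1` and `y` has
weight `1`. -/
def wt (s : ℕ) (d : Fin 2 →₀ ℕ) : ℕ := (s + 1) * d 0 + d 1

theorem wt_add (s : ℕ) (d e : Fin 2 →₀ ℕ) : wt s (d + e) = wt s d + wt s e := by
  simp only [wt, Finsupp.add_apply]; ring

/-- The ideal of power series all of whose monomials have weight at least `n`. -/
def ord (s n : ℕ) : Ideal Series where
  carrier := {f | ∀ d, wt s d < n → coeff d f = 0}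
  zero_mem' := fun d _ => by simp
  add_mem' := fun {f g} hf hg d hd => by rw [map_add, hf d hd, hg d hd, add_zero]
  smul_mem' := fun c f hf d hd => by
    classical
    rw [smul_eq_mul, coeff_mul]
    refine Finset.sum_eq_zero fun e he => ?_
    rw [Finset.HasAntidiagonal.mem_antidiagonal] at he
    rw [hf e.2 (by rw [← he, wt_add] at hd; omega), mul_zero]

theorem ord_anti (s : ℕ) {m n : ℕ} (h : m ≤ n) {f : Series} (hf : f ∈ ord s n) : f ∈ ord s m :=
  fun d hd => hf d (hd.trans_le h)

theorem mem_ord_zero (s : ℕ) (f : Series) : f ∈ ord s 0 := fun _ hd => absurd hd (Nat.not_lt_zero _)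

theorem mul_mem_ord {s m n : ℕ} {f g : Series} (hf : f ∈ ord s m) (hg : g ∈ ord s n) :
    f * g ∈ ord s (m + n) := by
  classical
  intro d hd
  rw [coeff_mul]
  refine Finset.sum_eq_zero fun e he => ?_
  rw [Finset.HasAntidiagonal.mem_antidiagonal] at he
  rw [← he, wt_add] at hd
  rcases lt_or_ge (wt s e.1) m with h | h
  · rw [hf _ h, zero_mul]
  · rw [hg _ (by omega), mul_zero]

theorem smul_mem_ord {s n : ℕ} (r : ℝ) {f : Series} (hf : f ∈ ord s n) : r • f ∈ ord s n := by
  rw [smul_eq_C_mul]; exact Ideal.mul_mem_left _ _ hf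

theorem X_zero_mem_ord (s : ℕ) : (X 0 : Series) ∈ ord s (s + 1) := by
  classical
  intro d hd
  rw [coeff_X, if_neg]
  rintro rfl
  simp [wt] at hd

theorem X_one_mem_ord (s : ℕ) : (X 1 : Series) ∈ ord s 1 := by
  classical
  intro d hd
  rw [coeff_X, if_neg]
  rintro rfl
  simp [wt] at hd

theorem pow_mem_ord {s m : ℕ} {f : Series} (hf : f ∈ ord s m) (n : ℕ) : f ^ n ∈ ord s (m * n) := by
  induction n with
  | zero => exact mem_ord_zero _ _
  | succ n ih => rw [pow_succ]; exact mul_mem_ord ih hf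

theorem monomial_mem_ord {s n : ℕ} (a b : ℕ) (h : n ≤ (s + 1) * a + b) :
    (X 0 ^ a * X 1 ^ b : Series) ∈ ord s n := by
  refine ord_anti s h (mul_mem_ord (pow_mem_ord (X_zero_mem_ord s) a) ?_)
  simpa using pow_mem_ord (X_one_mem_ord s) b

theorem pow_X_one_mem_ord {s n b : ℕ} (h : n ≤ b) : (X 1 ^ b : Series) ∈ ord s n := by
  simpa using monomial_mem_ord (s := s) 0 b (by simpa using h)

theorem eq_zero_of_forall_mem_ord {s : ℕ} {f : Series} (h : ∀ n, f ∈ ord s n) : f = 0 := by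
  ext d
  simpa using h (wt s d + 1) d (Nat.lt_succ_self _)

theorem constantCoeff_eq_zero_of_mem_ord {s n : ℕ} (hn : n ≠ 0) {f : Series} (hf : f ∈ ord s n) :
    constantCoeff f = 0 := by
  rw [← coeff_zero_eq_constantCoeff_apply]
  exact hf 0 (by simpa [wt] using Nat.pos_of_ne_zero hn)

theorem mem_ord_of_constantCoeff {s : ℕ} {f : Series} (hf : constantCoeff f = 0) :
    f ∈ ord s 1 := by
  intro d hd
  have : d = 0 := by
    ext i
    simp only [wt, Nat.lt_one_iff, Nat.add_eq_zero_iff, mul_eq_zero] at hd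
    fin_cases i
    · simpa using hd.1
    · simpa using hd.2
  rw [this, coeff_zero_eq_constantCoeff_apply, hf]

theorem coeff_monomial_pow (a b : ℕ) (d : Fin 2 →₀ ℕ) :
    coeff d (X 0 ^ a * X 1 ^ b : Series) = if d 0 = a ∧ d 1 = b then 1 else 0 := by
  classical
  rw [X_pow_eq, X_pow_eq, monomial_mul_monomial, mul_one, coeff_monomial]
  refine if_congr ⟨?_, ?_⟩ rfl rfl
  · rintro rfl; simp
  · rintro ⟨rfl, rfl⟩; ext i; fin_cases i <;> simp

/-- Only finitely many monomials have weight below N, and subtracting that truncation leaves an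
element of `ord s N`. Linear claims about all series thus reduce to monomials and a tail estimate,
with no topology. -/
theorem mem_of_mem_ord {s n N : ℕ} (S : Submodule ℝ Series)
    (hmon : ∀ a b, n ≤ (s + 1) * a + b → (s + 1) * a + b < N → (X 0 ^ a * X 1 ^ b : Series) ∈ S)
    (hS : ∀ f ∈ ord s N, f ∈ S) {f : Series} (hf : f ∈ ord s n) : f ∈ S := by
  classical
  let e : ℕ × ℕ → (Fin 2 →₀ ℕ) := fun p => Finsupp.single 0 p.1 + Finsupp.single 1 p.2
  let B : Finset (ℕ × ℕ) :=
    (Finset.range N ×ˢ Finset.range N).filter fun p => (s + 1) * p.1 + p.2 < N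
  let p : Series := ∑ q ∈ B, coeff (e q) f • (X 0 ^ q.1 * X 1 ^ q.2 : Series)
  have hp : p ∈ S := by
    refine S.sum_mem fun q hq => ?_
    rcases le_or_gt n ((s + 1) * q.1 + q.2) with h | h
    · exact S.smul_mem _ (hmon _ _ h (Finset.mem_filter.1 hq).2)
    · rw [hf (e q) (by simpa [wt, e] using h), zero_smul]
      exact S.zero_mem
  have hfp : f - p ∈ ord s N := by
    intro d hd
    have hd' : (s + 1) * d 0 + d 1 < N := hd
    have h0 : d 0 ≤ (s + 1) * d 0 := Nat.le_mul_of_pos_left _ (Nat.succ_pos _)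
    have hmem : (d 0, d 1) ∈ B := by
      simp only [B, Finset.mem_filter, Finset.mem_product, Finset.mem_range]
      omega
    have hed : e (d 0, d 1) = d := by ext i; fin_cases i <;> simp [e]
    rw [map_sub, map_sum, Finset.sum_eq_single (d 0, d 1)]
    · rw [map_smul, coeff_monomial_pow, hed]; simp
    · rintro ⟨a, b⟩ _ hne
      rw [map_smul, coeff_monomial_pow, if_neg, smul_zero]
      rintro ⟨rfl, rfl⟩
      exact hne rfl
    · exact fun h => absurd hmem h
  have := S.add_mem (hS _ hfp) hp
  rwa [sub_add_cancel] at this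

/-! ### Derivations and graded vector fields -/

theorem pderiv_zero_mem_ord {s n : ℕ} {f : Series} (hf : f ∈ ord s (n + s + 1)) :
    pderiv ℝ 0 f ∈ ord s n := by
  intro d hd
  rw [coeff_pderiv, hf _ _, zero_mul]
  rw [wt_add]; simp [wt] at hd ⊢; omega

theorem pderiv_one_mem_ord {s n : ℕ} {f : Series} (hf : f ∈ ord s (n + 1)) :
    pderiv ℝ 1 f ∈ ord s n := by
  intro d hd
  rw [coeff_pderiv, hf _ _, zero_mul]
  rw [wt_add]; simp [wt] at hd ⊢; omega

theorem pderiv_comm (i j : Fin 2) (f : Series) :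
    pderiv ℝ i (pderiv ℝ j f) = pderiv ℝ j (pderiv ℝ i f) := by
  by_cases h : i = j
  · rw [h]
  · ext d
    simp only [coeff_pderiv, Finsupp.add_apply, add_right_comm d]
    rw [Finsupp.single_eq_of_ne (Ne.symm h), Finsupp.single_eq_of_ne h]
    push_cast; ring

/-- The derivation `w 0 ∂/∂x + w 1 ∂/∂y`. -/
noncomputable def lieD (w : FormalVectorField) : Derivation ℝ Series Series :=
  w 0 • pderiv ℝ 0 + w 1 • pderiv ℝ 1

theorem lieD_apply (w : FormalVectorField) (f : Series) :
    lieD w f = w 0 * pderiv ℝ 0 f + w 1 * pderiv ℝ 1 f := rfl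

theorem transforms_iff {φ : Fin 2 → Series} {T : Series} {v w : FormalVectorField} :
    Transforms φ T v w ↔ ∀ i, lieD w (φ i) = T * subst φ (v i) := by
  simp only [Transforms, Fin.sum_univ_two, lieD_apply, mul_comm (w _)]

@[simp] theorem lieD_X (w : FormalVectorField) (i : Fin 2) : lieD w (X i) = w i := by
  fin_cases i <;> simp [lieD_apply, pderiv_X_of_ne]

@[simp] theorem lieD_mul (w : FormalVectorField) (f g : Series) :
    lieD w (f * g) = f * lieD w g + g * lieD w f := by
  simp

theorem lieD_add_left (v w : FormalVectorField) (f : Series) :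
    lieD (v + w) f = lieD v f + lieD w f := by
  simp only [lieD_apply, Pi.add_apply]; ring

theorem lieD_sub_left (v w : FormalVectorField) (f : Series) :
    lieD (v - w) f = lieD v f - lieD w f := by
  simp only [lieD_apply, Pi.sub_apply]; ring

theorem lieD_smul_left (r : ℝ) (w : FormalVectorField) (f : Series) :
    lieD (r • w) f = r • lieD w f := by
  simp only [lieD_apply, Pi.smul_apply, smul_add, smul_mul_assoc]

theorem lieD_smul_series_left (g : Series) (w : FormalVectorField) (f : Series) :
    lieD (g • w) f = g * lieD w f := by
  simp only [lieD_apply, Pi.smul_apply, smul_eq_mul]; ring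

/-- Vector fields of weighted degree at least `q`. -/
def vord (s q : ℕ) : Submodule ℝ FormalVectorField where
  carrier := {u | u 0 ∈ ord s (q + s + 1) ∧ u 1 ∈ ord s (q + 1)}
  zero_mem' := ⟨Ideal.zero_mem _, Ideal.zero_mem _⟩
  add_mem' := fun hf hg => ⟨Ideal.add_mem _ hf.1 hg.1, Ideal.add_mem _ hf.2 hg.2⟩
  smul_mem' := fun r _ hf => ⟨smul_mem_ord r hf.1, smul_mem_ord r hf.2⟩

theorem vord_anti (s : ℕ) {p q : ℕ} (h : p ≤ q) {u : FormalVectorField} (hu : u ∈ vord s q) :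
    u ∈ vord s p :=
  ⟨ord_anti s (by omega) hu.1, ord_anti s (by omega) hu.2⟩

theorem smul_mem_vord {s k q : ℕ} {g : Series} {u : FormalVectorField} (hg : g ∈ ord s k)
    (hu : u ∈ vord s q) : g • u ∈ vord s (k + q) :=
  ⟨by simpa [add_assoc] using mul_mem_ord hg hu.1, by simpa [add_assoc] using mul_mem_ord hg hu.2⟩

theorem lieD_mem_ord {s k n : ℕ} {Y : FormalVectorField} (hY : Y ∈ vord s k) {f : Series}
    (hf : f ∈ ord s n) : lieD Y f ∈ ord s (n + k) := by
  rw [lieD_apply]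
  refine Ideal.add_mem _ ?_ ?_
  -- When n is smaller than the weight lost by differentiating, the coefficient of the field alone
  -- has sufficient order.
  · rcases le_or_gt (s + 1) n with h | h
    · obtain ⟨m, rfl⟩ := Nat.exists_eq_add_of_le h
      refine ord_anti s ?_ (mul_mem_ord hY.1 (pderiv_zero_mem_ord (n := m) (ord_anti s ?_ hf))) <;>
        omega
    · exact ord_anti s (by omega) (Ideal.mul_mem_right _ _ hY.1)
  · rcases le_or_gt 1 n with h | h
    · obtain ⟨m, rfl⟩ := Nat.exists_eq_add_of_le h
      refine ord_anti s ?_ (mul_mem_ord hY.2 (pderiv_one_mem_ord (n := m) (ord_anti s ?_ hf))) <;>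
        omega
    · exact ord_anti s (by omega) (Ideal.mul_mem_right _ _ hY.2)

theorem lieD_comp_mem_vord {s k q : ℕ} {Y u : FormalVectorField} (hY : Y ∈ vord s k)
    (hu : u ∈ vord s q) : (fun i => lieD Y (u i)) ∈ vord s (q + k) :=
  ⟨ord_anti s (by omega) (lieD_mem_ord hY hu.1), ord_anti s (by omega) (lieD_mem_ord hY hu.2)⟩

/-! ### Substitution: orders, Taylor expansion, chain rule -/

theorem hasSubst_of_zero {φ : Fin 2 → Series} (hφ : ∀ i, constantCoeff (φ i) = 0) : HasSubst φ :=
  hasSubst_of_constantCoeff_zero hφ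

theorem subst_monomial_pow {φ : Fin 2 → Series} (hφ : HasSubst φ) (a b : ℕ) :
    subst φ (X 0 ^ a * X 1 ^ b : Series) = φ 0 ^ a * φ 1 ^ b := by
  rw [subst_mul hφ, subst_pow hφ, subst_pow hφ, subst_X hφ, subst_X hφ]

theorem subst_mem_ord {s n : ℕ} {φ : Fin 2 → Series} (h0 : φ 0 ∈ ord s (s + 1))
    (h1 : φ 1 ∈ ord s 1) {f : Series} (hf : f ∈ ord s n) : subst φ f ∈ ord s n := by
  have hφ : HasSubst φ := hasSubst_of_zero fun i => by
    fin_cases i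
    · exact constantCoeff_eq_zero_of_mem_ord (Nat.succ_ne_zero s) h0
    · exact constantCoeff_eq_zero_of_mem_ord one_ne_zero h1
  intro e he
  rw [coeff_subst hφ]
  refine finsum_eq_zero_of_forall_eq_zero fun d => ?_
  rcases lt_or_ge (wt s d) n with h | h
  · rw [hf d h, zero_smul]
  · have : (d.prod fun i m => φ i ^ m) ∈ ord s (wt s d) := by
      rw [Finsupp.prod_fintype _ _ (fun i => pow_zero _), Fin.prod_univ_two]
      refine mul_mem_ord (pow_mem_ord h0 _) ?_
      simpa using pow_mem_ord h1 (d 1)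
    rw [this e (by omega), smul_zero]

/-- For s = 0 the weight is the total degree, so vanishing constant terms suffice. -/
theorem subst_mem_ord_zero {n : ℕ} {φ : Fin 2 → Series} (hφ : ∀ i, constantCoeff (φ i) = 0)
    {f : Series} (hf : f ∈ ord 0 n) : subst φ f ∈ ord 0 n :=
  subst_mem_ord (mem_ord_of_constantCoeff (hφ 0)) (mem_ord_of_constantCoeff (hφ 1)) hf

theorem near_mem_ord {s k : ℕ} {φ : Fin 2 → Series} (hφ : φ - X ∈ vord s k) :
    φ 0 ∈ ord s (s + 1) ∧ φ 1 ∈ ord s 1 := by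
  have h0 : φ 0 = (φ - X : Fin 2 → Series) 0 + X 0 := by simp
  have h1 : φ 1 = (φ - X : Fin 2 → Series) 1 + X 1 := by simp
  rw [h0, h1]
  exact ⟨Ideal.add_mem _ (ord_anti s (by omega) hφ.1) (X_zero_mem_ord s),
    Ideal.add_mem _ (ord_anti s (by omega) hφ.2) (X_one_mem_ord s)⟩

theorem constantCoeff_of_mem_ord {s : ℕ} {φ : Fin 2 → Series}
    (h : φ 0 ∈ ord s (s + 1) ∧ φ 1 ∈ ord s 1) (i : Fin 2) : constantCoeff (φ i) = 0 := by
  fin_cases i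
  · exact constantCoeff_eq_zero_of_mem_ord (Nat.succ_ne_zero s) h.1
  · exact constantCoeff_eq_zero_of_mem_ord one_ne_zero h.2

/-- First order Taylor expansion of a substitution close to the identity. -/
theorem subst_sub_sub_lieD_mem_ord {s k n : ℕ} {φ : Fin 2 → Series} (hφ : φ - X ∈ vord s k)
    {f : Series} (hf : f ∈ ord s n) :
    subst φ f - f - lieD (φ - X) f ∈ ord s (n + 2 * k) := by
  have hord := near_mem_ord hφ
  have hs : HasSubst φ := hasSubst_of_zero (constantCoeff_of_mem_ord hord)
  let L : Series →ₗ[ℝ] Series :=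
    (substAlgHom hs).toLinearMap - LinearMap.id - (lieD (φ - X)).toLinearMap
  have hL : ∀ f, L f = subst φ f - f - lieD (φ - X) f := fun f => by
    simp [L]
  have hmul : ∀ m n : ℕ, ∀ f g : Series, f ∈ ord s m → g ∈ ord s n →
      L f ∈ ord s (m + 2 * k) → L g ∈ ord s (n + 2 * k) → L (f * g) ∈ ord s (m + n + 2 * k) := by
    intro m n f g hf hg hLf hLg
    have hYf := lieD_mem_ord hφ hf
    have hYg := lieD_mem_ord hφ hg
    -- The Taylor remainder obeys a twisted product rule whose defect is a product of two
    -- first-order terms, hence of order 2k. Since it vanishes on the variables, it is of order 2k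
    -- on every monomial.
    have key : L (f * g) = subst φ f * L g + g * L f + lieD (φ - X) f * lieD (φ - X) g
        + L f * lieD (φ - X) g := by
      rw [hL, hL, hL, subst_mul hs, lieD_mul]; ring
    rw [key]
    refine Ideal.add_mem _ (Ideal.add_mem _ (Ideal.add_mem _ ?_ ?_) ?_) ?_
    · exact ord_anti s (by omega) (mul_mem_ord (subst_mem_ord hord.1 hord.2 hf) hLg)
    · exact ord_anti s (by omega) (mul_mem_ord hg hLf)
    · exact ord_anti s (by omega) (mul_mem_ord hYf hYg)
    · exact ord_anti s (by omega) (mul_mem_ord hLf hYg)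
  have hX : ∀ i, L (X i) = 0 := fun i => by rw [hL, subst_X hs, lieD_X]; simp
  have h1 : L 1 = 0 := by
    rw [hL, ← substAlgHom_apply hs, map_one]; simp
  have hpow : ∀ i m, (X i : Series) ∈ ord s m → ∀ a : ℕ, L (X i ^ a) ∈ ord s (m * a + 2 * k) := by
    intro i m hi a
    induction a with
    | zero => rw [pow_zero, h1]; exact Ideal.zero_mem _
    | succ a ih =>
      rw [pow_succ]
      exact ord_anti s (by rw [Nat.mul_succ]) (hmul _ _ _ _ (pow_mem_ord hi a) hi ih
        (by rw [hX]; exact Ideal.zero_mem _))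
  rw [← hL]
  refine mem_of_mem_ord (s := s) (n := n) (N := n + 2 * k)
    (((ord s (n + 2 * k)).restrictScalars ℝ).comap L) ?_ ?_ hf
  · intro a b hab _
    change L _ ∈ ord s _
    refine ord_anti s ?_ (hmul _ _ _ _ (pow_mem_ord (X_zero_mem_ord s) a)
      (pow_mem_ord (X_one_mem_ord s) b) (hpow 0 _ (X_zero_mem_ord s) a)
      (hpow 1 _ (X_one_mem_ord s) b))
    rw [one_mul]; omega
  · intro f hf
    change L _ ∈ ord s _
    rw [hL]
    exact Ideal.sub_mem _ (Ideal.sub_mem _ (subst_mem_ord hord.1 hord.2 hf) hf)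
      (ord_anti s (by omega) (lieD_mem_ord hφ hf))

theorem subst_sub_mem_ord {s k n : ℕ} {φ : Fin 2 → Series} (hφ : φ - X ∈ vord s k)
    {f : Series} (hf : f ∈ ord s n) : subst φ f - f ∈ ord s (n + k) := by
  have h := Ideal.add_mem _ (ord_anti s (by omega) (subst_sub_sub_lieD_mem_ord hφ hf))
    (lieD_mem_ord hφ hf)
  rwa [sub_add_cancel] at h

/-- The chain rule. -/
theorem pderiv_subst {φ : Fin 2 → Series} (hφ : ∀ i, constantCoeff (φ i) = 0) (j : Fin 2)
    (f : Series) :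
    pderiv ℝ j (subst φ f) =
      subst φ (pderiv ℝ 0 f) * pderiv ℝ j (φ 0) + subst φ (pderiv ℝ 1 f) * pderiv ℝ j (φ 1) := by
  have hs := hasSubst_of_zero hφ
  let σ : Series →ₗ[ℝ] Series := (substAlgHom hs).toLinearMap
  let L : Series →ₗ[ℝ] Series := (pderiv ℝ j).toLinearMap ∘ₗ σ
    - LinearMap.mulRight ℝ (pderiv ℝ j (φ 0)) ∘ₗ σ ∘ₗ (pderiv ℝ 0).toLinearMap
    - LinearMap.mulRight ℝ (pderiv ℝ j (φ 1)) ∘ₗ σ ∘ₗ (pderiv ℝ 1).toLinearMap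
  have hL : ∀ f, L f = pderiv ℝ j (subst φ f) - subst φ (pderiv ℝ 0 f) * pderiv ℝ j (φ 0)
      - subst φ (pderiv ℝ 1 f) * pderiv ℝ j (φ 1) := fun f => by
    simp [L, σ]
  have hmul : ∀ f g, L f = 0 → L g = 0 → L (f * g) = 0 := by
    intro f g hf hg
    have key : L (f * g) = subst φ f * L g + subst φ g * L f := by
      simp only [hL, Derivation.leibniz, smul_eq_mul, subst_mul hs, subst_add hs]; ring
    rw [key, hf, hg, mul_zero, mul_zero, add_zero]
  have e0 : subst φ (0 : Series) = 0 := by rw [← substAlgHom_apply hs, map_zero]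
  have e1 : subst φ (1 : Series) = 1 := by rw [← substAlgHom_apply hs, map_one]
  have h1 : L 1 = 0 := by
    rw [hL, e1, pderiv_one, pderiv_one, pderiv_one, e0, zero_mul, zero_mul, sub_zero, sub_zero]
  have hX : ∀ i, L (X i) = 0 := by
    intro i
    rw [hL, subst_X hs]
    fin_cases i <;> simp [pderiv_X_of_ne, e0, e1]
  have hpow : ∀ i (a : ℕ), L (X i ^ a) = 0 := by
    intro i a
    induction a with
    | zero => rw [pow_zero, h1]
    | succ a ih => rw [pow_succ]; exact hmul _ _ ih (hX i)
  suffices L f = 0 by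
    rw [hL, sub_sub, sub_eq_zero] at this
    exact this
  have hpd : ∀ (i : Fin 2) (n : ℕ) (g : Series), g ∈ ord 0 (n + 1) → pderiv ℝ i g ∈ ord 0 n := by
    intro i n g hg
    fin_cases i
    · exact pderiv_zero_mem_ord hg
    · exact pderiv_one_mem_ord hg
  -- The defect kills all monomials. Total degree (s = 0) is used for the tail because there both
  -- partial derivatives lower the order by exactly one.
  refine eq_zero_of_forall_mem_ord (s := 0) fun n => ?_
  refine mem_of_mem_ord (s := 0) (n := 0) (N := n + 1)
    (((ord 0 n).restrictScalars ℝ).comap L) ?_ ?_ (mem_ord_zero 0 f)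
  · intro a b _ _
    change L _ ∈ ord 0 _
    rw [hmul _ _ (hpow 0 a) (hpow 1 b)]
    exact Ideal.zero_mem _
  · intro f hf
    change L _ ∈ ord 0 _
    rw [hL]
    exact Ideal.sub_mem _ (Ideal.sub_mem _ (hpd j n _ (subst_mem_ord_zero hφ hf))
      (Ideal.mul_mem_right _ _ (subst_mem_ord_zero hφ (hpd 0 n _ hf))))
      (Ideal.mul_mem_right _ _ (subst_mem_ord_zero hφ (hpd 1 n _ hf)))

theorem lieD_subst {φ : Fin 2 → Series} (hφ : ∀ i, constantCoeff (φ i) = 0)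
    (w : FormalVectorField) (f : Series) :
    lieD w (subst φ f) =
      subst φ (pderiv ℝ 0 f) * lieD w (φ 0) + subst φ (pderiv ℝ 1 f) * lieD w (φ 1) := by
  rw [lieD_apply, pderiv_subst hφ, pderiv_subst hφ, lieD_apply, lieD_apply]; ring

theorem constantCoeff_subst_eq {φ : Fin 2 → Series} (hφ : ∀ i, constantCoeff (φ i) = 0)
    (f : Series) : constantCoeff (subst φ f) = constantCoeff f := by
  have hs := hasSubst_of_zero hφ
  have h := constantCoeff_subst_eq_zero hs hφ (f := f - C (constantCoeff f)) (by simp)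
  rw [subst_sub hs, map_sub, subst_C, constantCoeff_C, sub_eq_zero] at h
  exact h

/-! ### Composition and inversion of the Jacobian -/

/-- The change of variables `φ` followed by the change of variables `ψ`. -/
noncomputable def comp (φ ψ : Fin 2 → Series) : Fin 2 → Series := fun i => subst ψ (φ i)

theorem constantCoeff_comp {φ ψ : Fin 2 → Series} (hφ : ∀ i, constantCoeff (φ i) = 0)
    (hψ : ∀ i, constantCoeff (ψ i) = 0) (i : Fin 2) : constantCoeff (comp φ ψ i) = 0 := by
  rw [comp, constantCoeff_subst_eq hψ, hφ]

theorem transforms_comp {φ ψ : Fin 2 → Series} {T S : Series} {v w u : FormalVectorField}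
    (hφ : ∀ i, constantCoeff (φ i) = 0) (hψ : ∀ i, constantCoeff (ψ i) = 0)
    (h₁ : Transforms φ T v w) (h₂ : Transforms ψ S w u) :
    Transforms (comp φ ψ) (subst ψ T * S) v u := by
  rw [transforms_iff] at *
  have hs := hasSubst_of_zero hψ
  intro i
  have h : subst ψ (lieD w (φ i)) = subst ψ (T * subst φ (v i)) := by rw [h₁]
  rw [lieD_apply, subst_add hs, subst_mul hs, subst_mul hs, subst_mul hs,
    subst_comp_subst_apply (hasSubst_of_zero hφ) hs] at h
  rw [comp, lieD_subst hψ, h₂, h₂]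
  change _ = subst ψ T * S * subst (fun i => subst ψ (φ i)) (v i)
  linear_combination S * h

theorem linearPart_apply (φ : Fin 2 → Series) (i j : Fin 2) :
    linearPart φ i j = constantCoeff (pderiv ℝ j (φ i)) := by
  rw [← coeff_zero_eq_constantCoeff_apply, coeff_pderiv]
  simp [linearPart]

theorem linearPart_comp {φ ψ : Fin 2 → Series} (hψ : ∀ i, constantCoeff (ψ i) = 0) :
    linearPart (comp φ ψ) = linearPart φ * linearPart ψ := by
  ext i j
  rw [Matrix.mul_apply, Fin.sum_univ_two]
  simp only [linearPart_apply, comp, pderiv_subst hψ, map_add, map_mul,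
    constantCoeff_subst_eq hψ]

theorem isStateChange_comp {φ ψ : Fin 2 → Series} (hφ : IsStateChange φ) (hψ : IsStateChange ψ) :
    IsStateChange (comp φ ψ) :=
  ⟨constantCoeff_comp hφ.1 hψ.1, by
    rw [linearPart_comp hψ.1, Matrix.det_mul]; exact mul_ne_zero hφ.2 hψ.2⟩

theorem isNearIdentity_comp {φ ψ : Fin 2 → Series} (hφ : IsNearIdentity φ)
    (hψ : IsNearIdentity ψ) : IsNearIdentity (comp φ ψ) :=
  ⟨constantCoeff_comp hφ.1 hψ.1, by rw [linearPart_comp hψ.1, hφ.2, hψ.2, one_mul]⟩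

theorem isStateChange_of_isNearIdentity {φ : Fin 2 → Series} (hφ : IsNearIdentity φ) :
    IsStateChange φ := ⟨hφ.1, by rw [hφ.2]; simp⟩

/-- The Jacobian determinant of a pair of series. -/
noncomputable def jac (φ : Fin 2 → Series) : Series :=
  pderiv ℝ 0 (φ 0) * pderiv ℝ 1 (φ 1) - pderiv ℝ 1 (φ 0) * pderiv ℝ 0 (φ 1)

theorem isUnit_jac {φ : Fin 2 → Series} (hφ : IsStateChange φ) : IsUnit (jac φ) := by
  rw [MvPowerSeries.isUnit_iff_constantCoeff, isUnit_iff_ne_zero]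
  have h := hφ.2
  rw [Matrix.det_fin_two] at h
  simpa only [linearPart_apply, jac, map_sub, map_mul] using h

theorem exists_lieD_eq {φ : Fin 2 → Series} (hφ : IsStateChange φ) (R : Fin 2 → Series) :
    ∃ w : FormalVectorField, ∀ i, lieD w (φ i) = R i := by
  obtain ⟨d, hd⟩ := (isUnit_jac hφ).exists_right_inv
  rw [jac] at hd
  refine ⟨![d * (pderiv ℝ 1 (φ 1) * R 0 - pderiv ℝ 1 (φ 0) * R 1),
    d * (pderiv ℝ 0 (φ 0) * R 1 - pderiv ℝ 0 (φ 1) * R 0)], fun i => ?_⟩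
  rw [lieD_apply]
  fin_cases i
  · simp only [Matrix.cons_val_zero, Matrix.cons_val_one, Fin.zero_eta]
    linear_combination R 0 * hd
  · simp only [Matrix.cons_val_zero, Matrix.cons_val_one, Fin.mk_one]
    linear_combination R 1 * hd

theorem exists_transforms {φ : Fin 2 → Series} (hφ : IsStateChange φ) (T : Series)
    (v : FormalVectorField) : ∃ w, Transforms φ T v w := by
  simp only [transforms_iff]
  exact exists_lieD_eq hφ _

/-- Cramer's rule. The two components of a graded field differ in order by s, and the off-diagonal
entry ∂(φ 0)/∂y has order at least s, which compensates exactly. Estimates of Dφ · δ thereby become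
estimates of δ. -/
theorem mem_vord_of_lieD {s q : ℕ} {φ : Fin 2 → Series} (hφ : IsStateChange φ)
    (h0 : φ 0 ∈ ord s (s + 1)) {δ : FormalVectorField}
    (hR : (fun i => lieD δ (φ i)) ∈ vord s q) : δ ∈ vord s q := by
  obtain ⟨d, hd⟩ := (isUnit_jac hφ).exists_right_inv
  rw [jac] at hd
  obtain ⟨hR0, hR1⟩ := hR
  simp only [lieD_apply] at hR0 hR1
  set R0 := δ 0 * pderiv ℝ 0 (φ 0) + δ 1 * pderiv ℝ 1 (φ 0)
  set R1 := δ 0 * pderiv ℝ 0 (φ 1) + δ 1 * pderiv ℝ 1 (φ 1)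
  have e0 : δ 0 = d * (pderiv ℝ 1 (φ 1) * R0 - pderiv ℝ 1 (φ 0) * R1) := by
    simp only [R0, R1]; linear_combination (-δ 0) * hd
  have e1 : δ 1 = d * (pderiv ℝ 0 (φ 0) * R1 - pderiv ℝ 0 (φ 1) * R0) := by
    simp only [R0, R1]; linear_combination (-δ 1) * hd
  refine ⟨?_, ?_⟩
  · rw [e0]
    refine Ideal.mul_mem_left _ _ (Ideal.sub_mem _ (Ideal.mul_mem_left _ _ hR0) ?_)
    exact ord_anti s (by omega) (mul_mem_ord (pderiv_one_mem_ord h0) hR1)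
  · rw [e1]
    exact Ideal.mul_mem_left _ _ (Ideal.sub_mem _ (Ideal.mul_mem_left _ _ hR1)
      (ord_anti s (by omega) (Ideal.mul_mem_left _ _ hR0)))

/-- For k ≤ s the field x ∂/∂y has weighted degree at least k, so the grading alone does not exclude
this linear term. -/
theorem isNearIdentity_of_mem_vord {s k : ℕ} (hk : 1 ≤ k) {φ : Fin 2 → Series}
    (hφ : φ - X ∈ vord s k) (hlin : coeff (Finsupp.single 0 1) (φ 1) = 0) : IsNearIdentity φ := by
  have hord := near_mem_ord hφ
  refine ⟨constantCoeff_of_mem_ord hord, ?_⟩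
  have e : ∀ i, φ i = X i + (φ - X : Fin 2 → Series) i := fun i => by simp
  ext i j
  fin_cases i
  · have h := hφ.1 (Finsupp.single j 1) (by fin_cases j <;> simp [wt] <;> omega)
    change coeff (Finsupp.single j 1) (φ 0) = _
    rw [e, map_add, h]
    fin_cases j <;> simp [coeff_X, Finsupp.single_left_inj]
  · fin_cases j
    · simpa [linearPart] using hlin
    · have h := hφ.2 (Finsupp.single 1 1) (by simp [wt]; omega)
      change coeff (Finsupp.single 1 1) (φ 1) = _
      rw [e, map_add, h]
      simp [coeff_X]

/-- Modulo the ideal `ord s n` the two substitutions agree on monomials, and both send series of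
weight at least n into the ideal. -/
theorem subst_sub_subst_mem_ord {s n : ℕ} {φ ψ : Fin 2 → Series}
    (hφ : φ 0 ∈ ord s (s + 1) ∧ φ 1 ∈ ord s 1) (hψ : ψ 0 ∈ ord s (s + 1) ∧ ψ 1 ∈ ord s 1)
    (h : ∀ i, φ i - ψ i ∈ ord s n) (f : Series) : subst φ f - subst ψ f ∈ ord s n := by
  have h₁ : HasSubst φ := hasSubst_of_zero (constantCoeff_of_mem_ord hφ)
  have h₂ : HasSubst ψ := hasSubst_of_zero (constantCoeff_of_mem_ord hψ)
  let L : Series →ₗ[ℝ] Series := (substAlgHom h₁).toLinearMap - (substAlgHom h₂).toLinearMap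
  have hL : ∀ f, L f = subst φ f - subst ψ f := fun f => by simp [L]
  rw [← hL]
  refine mem_of_mem_ord (s := s) (n := 0) (N := n)
    (((ord s n).restrictScalars ℝ).comap L) ?_ ?_ (mem_ord_zero s f)
  · intro a b _ _
    change L _ ∈ ord s n
    rw [hL, subst_monomial_pow h₁, subst_monomial_pow h₂]
    simp only [← Ideal.Quotient.eq, map_mul, map_pow] at h ⊢
    rw [h, h]
  · intro f hf
    change L _ ∈ ord s n
    rw [hL]
    exact Ideal.sub_mem _ (subst_mem_ord hφ.1 hφ.2 hf) (subst_mem_ord hψ.1 hψ.2 hf)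

/-- A sequence of series that is Cauchy for the weighted order has a limit. -/
theorem exists_limit {s : ℕ} (f : ℕ → Series) (hf : ∀ n, f (n + 1) - f n ∈ ord s n) :
    ∃ g : Series, ∀ n, g - f n ∈ ord s n := by
  have hmono : ∀ m n, m ≤ n → f n - f m ∈ ord s m := by
    intro m n hmn
    induction n, hmn using Nat.le_induction with
    | base => rw [sub_self]; exact Ideal.zero_mem _
    | succ n hmn ih =>
      have := Ideal.add_mem _ (ord_anti s hmn (hf n)) ih
      rwa [sub_add_sub_cancel] at this
  -- The coefficient at d no longer changes from index `wt s d + 1` on.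
  let g : Series := fun d => coeff d (f (wt s d + 1))
  have hg : ∀ d, coeff d g = coeff d (f (wt s d + 1)) := fun d => rfl
  refine ⟨g, fun n d hd => ?_⟩
  have h := hmono (wt s d + 1) n hd d (Nat.lt_succ_self _)
  rw [map_sub, sub_eq_zero] at h ⊢
  rw [h, hg]

/-! ### The leading field and Lie brackets -/

/-- The leading part `x y^s ∂/∂x + (-x + y^(s+1)) ∂/∂y` of a generalized saddle-node. -/
noncomputable def leadingField (s : ℕ) : FormalVectorField :=
  ![X 0 * X 1 ^ s, -X 0 + X 1 ^ (s + 1)]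

/-- The Lie bracket of vector fields. -/
noncomputable def bracket (u v : FormalVectorField) : FormalVectorField :=
  fun i => lieD u (v i) - lieD v (u i)

theorem leadingField_mem_vord (s : ℕ) : leadingField s ∈ vord s s := by
  refine ⟨?_, ?_⟩
  · exact ord_anti s (by omega) (mul_mem_ord (X_zero_mem_ord s)
      (pow_X_one_mem_ord (s := s) (le_refl s)))
  · exact Ideal.add_mem _ (Ideal.neg_mem_iff _ |>.2 (X_zero_mem_ord s))
      (pow_X_one_mem_ord (le_refl _))

theorem bracket_mem_vord {s p q : ℕ} {u v : FormalVectorField} (hu : u ∈ vord s p)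
    (hv : v ∈ vord s q) : bracket u v ∈ vord s (p + q) :=
  Submodule.sub_mem _ (add_comm q p ▸ lieD_comp_mem_vord hu hv) (lieD_comp_mem_vord hv hu)

theorem bracket_add_left (u v w : FormalVectorField) :
    bracket (u + v) w = bracket u w + bracket v w := by
  ext1 i; simp only [bracket, Pi.add_apply, lieD_add_left, map_add]; ring

theorem bracket_add_right (u v w : FormalVectorField) :
    bracket u (v + w) = bracket u v + bracket u w := by
  ext1 i; simp only [bracket, Pi.add_apply, lieD_add_left, map_add]; ring

theorem bracket_smul_left (r : ℝ) (u w : FormalVectorField) :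
    bracket (r • u) w = r • bracket u w := by
  ext1 i; simp only [bracket, Pi.smul_apply, lieD_smul_left, Derivation.map_smul, smul_sub]

theorem bracket_smul_right (r : ℝ) (u w : FormalVectorField) :
    bracket u (r • w) = r • bracket u w := by
  ext1 i; simp only [bracket, Pi.smul_apply, lieD_smul_left, Derivation.map_smul, smul_sub]

theorem lieD_bracket (u v : FormalVectorField) (f : Series) :
    lieD (bracket u v) f = lieD u (lieD v f) - lieD v (lieD u f) := by
  simp only [lieD_apply, bracket, map_add, Derivation.leibniz, smul_eq_mul, pderiv_comm 1 0]
  ring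

theorem bracket_jacobi (u v w : FormalVectorField) :
    bracket u (bracket v w) = bracket (bracket u v) w + bracket v (bracket u w) := by
  ext1 i
  simp only [Pi.add_apply]
  simp only [bracket.eq_def _ (bracket _ _), bracket.eq_def (bracket _ _) w, lieD_bracket]
  simp only [bracket, map_sub]
  ring

theorem bracket_smul_series_right (g : Series) (u w : FormalVectorField) :
    bracket u (g • w) = lieD u g • w + g • bracket u w := by
  ext1 i
  simp only [bracket, Pi.smul_apply, Pi.add_apply, smul_eq_mul, lieD_mul, lieD_smul_series_left]
  ring

theorem lieD_X_pow (w : FormalVectorField) (i : Fin 2) (n : ℕ) :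
    lieD w (X i ^ (n + 1)) = ((n : ℝ) + 1) • (X i ^ n * w i) := by
  rw [Derivation.leibniz_pow, lieD_X, Nat.add_sub_cancel, smul_eq_mul, ← Nat.cast_smul_eq_nsmul ℝ]
  push_cast; rfl

theorem lieD_one (w : FormalVectorField) : lieD w 1 = 0 := by simp

/-! ### The tangent space of the orbital action and its cokernel -/

/-- The infinitesimal orbital action of degree `k` on the leading part: the fields
`g V + [Y, V]` with `V = leadingField s`, `g` and `Y` of weighted degree at least `k` and no term
`x ∂/∂y` in `Y`. -/
noncomputable def tangent (s k : ℕ) : Submodule ℝ FormalVectorField where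
  carrier := {U | ∃ Y ∈ vord s k, ∃ g ∈ ord s k, coeff (Finsupp.single 0 1) (Y 1) = 0 ∧
    U = g • leadingField s + bracket Y (leadingField s)}
  zero_mem' := ⟨0, Submodule.zero_mem _, 0, Ideal.zero_mem _, by simp, by
    ext1 i; simp [bracket, lieD_apply]⟩
  add_mem' := by
    rintro _ _ ⟨Y, hY, g, hg, hl, rfl⟩ ⟨Z, hZ, h, hh, hl', rfl⟩
    refine ⟨Y + Z, Submodule.add_mem _ hY hZ, g + h, Ideal.add_mem _ hg hh, ?_, ?_⟩
    · rw [Pi.add_apply, map_add, hl, hl', add_zero]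
    · rw [bracket_add_left, add_smul]; abel
  smul_mem' := by
    rintro r _ ⟨Y, hY, g, hg, hl, rfl⟩
    refine ⟨r • Y, Submodule.smul_mem _ r hY, r • g, smul_mem_ord r hg, ?_, ?_⟩
    · rw [Pi.smul_apply, map_smul, hl, smul_zero]
    · rw [bracket_smul_left, smul_add, smul_assoc]

theorem mem_tangent {s k : ℕ} {Y : FormalVectorField} {g : Series} (hY : Y ∈ vord s k)
    (hg : g ∈ ord s k) (hl : coeff (Finsupp.single 0 1) (Y 1) = 0) :
    g • leadingField s + bracket Y (leadingField s) ∈ tangent s k :=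
  ⟨Y, hY, g, hg, hl, rfl⟩

theorem tangent_le_vord (s k : ℕ) : tangent s k ≤ vord s (s + k) := by
  rintro _ ⟨Y, hY, g, hg, -, rfl⟩
  rw [add_comm]
  exact Submodule.add_mem _ (smul_mem_vord hg (leadingField_mem_vord s))
    (bracket_mem_vord hY (leadingField_mem_vord s))

/-- The field `x^a y^b (x ∂/∂x + y ∂/∂y)`. -/
noncomputable def eulerField (a b : ℕ) : FormalVectorField :=
  ![X 0 ^ (a + 1) * X 1 ^ b, X 0 ^ a * X 1 ^ (b + 1)]

/-- The field `y^n ∂/∂x`. -/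
noncomputable def xField (n : ℕ) : FormalVectorField := ![X 1 ^ n, 0]

/-- The field `y^n ∂/∂y`. -/
noncomputable def yField (n : ℕ) : FormalVectorField := ![0, X 1 ^ n]

theorem eulerField_mem_vord {s a b q : ℕ} (h : q ≤ (s + 1) * a + b) :
    eulerField a b ∈ vord s q :=
  ⟨monomial_mem_ord _ _ (by rw [Nat.mul_succ]; omega), monomial_mem_ord _ _ (by omega)⟩

theorem xField_mem_vord {s n q : ℕ} (h : q + s + 1 ≤ n) : xField n ∈ vord s q :=
  ⟨pow_X_one_mem_ord h, Ideal.zero_mem _⟩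

theorem yField_mem_vord {s n q : ℕ} (h : q + 1 ≤ n) : yField n ∈ vord s q :=
  ⟨Ideal.zero_mem _, pow_X_one_mem_ord h⟩

theorem lieD_eulerField_X_pow (a b : ℕ) (i : Fin 2) (n : ℕ) :
    lieD (eulerField a b) (X i ^ n) = (n : ℝ) • (X 0 ^ a * X 1 ^ b * X i ^ n) := by
  cases n with
  | zero => simp
  | succ n =>
    rw [lieD_X_pow]
    push_cast
    congr 1
    fin_cases i
    · simp only [eulerField, Matrix.cons_val_zero, Fin.zero_eta]; ring
    · simp only [eulerField, Matrix.cons_val_one, Fin.mk_one, Matrix.cons_val_zero]; ring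

theorem coeff_single_zero_mul_X_one (f : Series) (n : ℕ) :
    coeff (Finsupp.single 0 1) (f * X 1 ^ (n + 1)) = 0 :=
  X_dvd_iff.1 (Dvd.dvd.mul_left (dvd_pow_self _ (Nat.succ_ne_zero n)) f) _ (by simp)

/-- With V₀ = y^s E - x ∂/∂y one has [E, V₀] = s y^s E, so [hE, V₀] = (s y^s h - V₀(h)) E for h =
x^a y^(b+1). -/
theorem bracket_eulerField_leadingField_succ (s a b : ℕ) :
    bracket (eulerField a (b + 1)) (leadingField s) =
      ((b : ℝ) + 1) • eulerField (a + 1) b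
        - ((a : ℝ) + (b + 1) - s) • eulerField a (b + 1 + s) := by
  ext1 i
  fin_cases i
  · simp only [bracket, leadingField, Matrix.cons_val_zero, Fin.zero_eta, lieD_mul,
      lieD_eulerField_X_pow, Pi.sub_apply, Pi.smul_apply, lieD_X]
    simp only [eulerField, Matrix.cons_val_zero, lieD_mul, lieD_X_pow, smul_eq_C_mul,
      Matrix.cons_val_one, map_add, map_sub, map_natCast, map_one]
    ring
  · simp only [bracket, leadingField, Matrix.cons_val_zero, Matrix.cons_val_one, Fin.mk_one,
      lieD_eulerField_X_pow, Pi.sub_apply, Pi.smul_apply, lieD_X, map_add, map_neg]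
    cases a <;>
    simp only [eulerField, Matrix.cons_val_zero, lieD_mul, lieD_X_pow, smul_eq_C_mul, pow_zero,
      Matrix.cons_val_one, map_add, map_sub, map_natCast, map_one, lieD_one, Nat.cast_add,
      Nat.cast_one, Nat.cast_zero, map_zero] <;>
    ring

theorem bracket_eulerField_leadingField_zero (s a : ℕ) :
    bracket (eulerField a 0) (leadingField s) = - (((a : ℝ) - s) • eulerField a s) := by
  ext1 i
  fin_cases i
  · simp only [bracket, leadingField, Matrix.cons_val_zero, Fin.zero_eta, lieD_mul,
      lieD_eulerField_X_pow, Pi.neg_apply, Pi.smul_apply, lieD_X]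
    simp only [eulerField, Matrix.cons_val_zero, lieD_mul, lieD_X_pow, smul_eq_C_mul,
      map_add, map_sub, map_natCast, map_one, pow_zero, lieD_one]
    ring
  · simp only [bracket, leadingField, Matrix.cons_val_zero, Matrix.cons_val_one, Fin.mk_one,
      lieD_eulerField_X_pow, Pi.neg_apply, Pi.smul_apply, lieD_X, map_add, map_neg]
    cases a <;>
    simp only [eulerField, Matrix.cons_val_zero, lieD_mul, lieD_X_pow, smul_eq_C_mul, pow_zero,
      Matrix.cons_val_one, map_add, map_sub, map_natCast, map_one, Nat.cast_add,
      Nat.cast_one, Nat.cast_zero, lieD_X, pow_one, zero_add, one_mul, map_zero] <;>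
    ring

/-- Homogeneity gives [hE, gE] = (deg g - deg h) hg E. -/
theorem bracket_eulerField_eulerField (s a b : ℕ) :
    bracket (eulerField s 0) (eulerField a b) = ((a : ℝ) + b - s) • eulerField (a + s) b := by
  ext1 i
  fin_cases i <;>
  · simp only [bracket, Pi.smul_apply]
    simp only [eulerField, Matrix.cons_val_zero, Matrix.cons_val_one, Fin.zero_eta, Fin.mk_one]
    change lieD (eulerField s 0) _ - lieD (eulerField a b) _ = _
    simp only [lieD_mul, lieD_eulerField_X_pow, smul_eq_C_mul, map_add, map_sub, map_natCast,
      Nat.cast_add, Nat.cast_one, map_one]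
    ring

theorem bracket_eulerField_self_leadingField (s : ℕ) :
    bracket (eulerField s 0) (leadingField s) = 0 := by
  rw [bracket_eulerField_leadingField_zero, sub_self, zero_smul, neg_zero]

theorem bracket_eulerField_mem_tangent {s k a b : ℕ} (h : k ≤ (s + 1) * a + b) :
    bracket (eulerField a b) (leadingField s) ∈ tangent s k := by
  have := mem_tangent (eulerField_mem_vord h) (Ideal.zero_mem _)
    (coeff_single_zero_mul_X_one (X 0 ^ a) b)
  rwa [zero_smul, zero_add] at this

theorem eulerField_relation_succ (s a b : ℕ) :
    ((a : ℝ) + (b + 1) - s) • eulerField a (b + 1 + s) - ((b : ℝ) + 1) • eulerField (a + 1) b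
      ∈ tangent s ((s + 1) * a + (b + 1)) := by
  have := Submodule.neg_mem _
    (bracket_eulerField_mem_tangent (s := s) (le_refl ((s + 1) * a + (b + 1))))
  rwa [bracket_eulerField_leadingField_succ, neg_sub] at this

theorem eulerField_relation_zero (s a : ℕ) :
    ((a : ℝ) - s) • eulerField a s ∈ tangent s ((s + 1) * a) := by
  have := Submodule.neg_mem _
    (bracket_eulerField_mem_tangent (s := s) (le_refl ((s + 1) * a + 0)))
  rwa [bracket_eulerField_leadingField_zero, neg_neg] at this

/-- The time factor -(k+1) y^k is chosen so that the x y^k ∂/∂y terms of the bracket and of the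
rescaling cancel. -/
theorem yField_relation (s k : ℕ) :
    (k : ℝ) • yField (s + k + 1) - ((s : ℝ) + k + 1) • eulerField 0 (k + s) ∈ tangent s k := by
  have h := mem_tangent (s := s) (k := k) (Y := (-1 : ℝ) • yField (k + 1))
    (g := (-((k : ℝ) + 1)) • X 1 ^ k)
    (Submodule.smul_mem _ _ (yField_mem_vord (le_refl _)))
    (smul_mem_ord _ (pow_X_one_mem_ord (le_refl _)))
    (by
      have := coeff_single_zero_mul_X_one 1 k
      simp only [Pi.smul_apply, map_smul, yField, Matrix.cons_val_one, Matrix.cons_val_zero]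
      rw [one_mul] at this
      rw [this, smul_zero])
  convert h using 1
  rw [bracket_smul_left]
  ext1 i
  fin_cases i
  · simp only [bracket, leadingField, Matrix.cons_val_zero, Fin.zero_eta,
      lieD_mul, Pi.sub_apply, Pi.smul_apply, Pi.add_apply, lieD_X]
    cases s <;>
    simp only [eulerField, yField, Matrix.cons_val_zero, lieD_X_pow, smul_eq_C_mul, pow_zero,
      Matrix.cons_val_one, map_add, map_neg, map_natCast, map_one, lieD_one, Nat.cast_add,
      Nat.cast_one, Nat.cast_zero, map_zero, smul_eq_mul] <;>
    ring
  · simp only [bracket, leadingField, Matrix.cons_val_zero, Fin.mk_one,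
      Pi.sub_apply, Pi.smul_apply, Pi.add_apply, lieD_X,
      Matrix.cons_val_one, map_add, map_neg]
    simp only [eulerField, yField, Matrix.cons_val_zero, lieD_X_pow, smul_eq_C_mul, pow_zero,
      Matrix.cons_val_one, map_add, map_neg, map_natCast, map_one, smul_eq_mul]
    ring

theorem xField_relation (s k : ℕ) :
    ((s : ℝ) + k) • xField (2 * s + k + 1) + ((s : ℝ) + k + 2) • yField (s + k + 1)
      - ((s : ℝ) + k + 1) • eulerField 0 (k + s) ∈ tangent s k := by
  have h := mem_tangent (s := s) (k := k) (Y := (-1 : ℝ) • xField (s + k + 1)) (g := 0)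
    (Submodule.smul_mem _ _ (xField_mem_vord (by omega)))
    (Ideal.zero_mem _) (by simp [xField])
  convert h using 1
  rw [bracket_smul_left]
  ext1 i
  fin_cases i
  · simp only [bracket, leadingField, Matrix.cons_val_zero, Fin.zero_eta,
      lieD_mul, Pi.sub_apply, Pi.smul_apply, Pi.add_apply, lieD_X]
    cases s <;>
    simp only [eulerField, xField, yField, Matrix.cons_val_zero, lieD_X_pow, smul_eq_C_mul,
      Matrix.cons_val_one, map_add, map_neg, map_natCast, map_one, lieD_one, Nat.cast_add,
      Nat.cast_one, Nat.cast_zero, map_zero, map_ofNat, smul_eq_mul, pow_zero] <;>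
    ring
  · simp only [bracket, leadingField, Matrix.cons_val_zero, Fin.mk_one,
      Pi.sub_apply, Pi.smul_apply, Pi.add_apply, lieD_X,
      Matrix.cons_val_one, map_add, map_neg]
    simp only [eulerField, xField, yField, Matrix.cons_val_zero, lieD_X_pow, smul_eq_C_mul,
      Matrix.cons_val_one, map_add, map_neg, map_natCast, map_one, map_zero, pow_zero,
      smul_eq_mul, map_ofNat]
    ring

/-- Modulo `tangent s k`, the field `y^(2s+k+1) ∂/∂x` is a nonzero multiple of
`y^(k+s) (x ∂/∂x + y ∂/∂y)`. -/
theorem exists_xField_sub_mem_tangent (s : ℕ) {k : ℕ} (hk : 1 ≤ k) :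
    ∃ μ : ℝ, μ ≠ 0 ∧ xField (2 * s + k + 1) - μ • eulerField 0 (k + s) ∈ tangent s k := by
  have hk' : (0 : ℝ) < k := by exact_mod_cast hk
  have hsk : (s : ℝ) + k ≠ 0 := by positivity
  -- The constant results from eliminating y^(s+k+1) ∂/∂y between `xField_relation` and
  -- `yField_relation`.
  refine ⟨-(((s : ℝ) + 2) * (s + k + 1) / (k * (s + k))), ?_, ?_⟩
  · apply neg_ne_zero.2; positivity
  have h := Submodule.sub_mem _ (Submodule.smul_mem _ ((s : ℝ) + k)⁻¹ (xField_relation s k))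
    (Submodule.smul_mem _ (((s : ℝ) + k + 2) / (k * (s + k))) (yField_relation s k))
  convert h using 1
  match_scalars <;> field_simp <;> ring

/-- Each relation trades one power of x for y^(s+1), with factor (a+b+1-s)/(b+1); ν is the product
of these factors. The positivity clause later guarantees that x^s y^(k+s) E is not tangent by
accident of a zero factor. -/
theorem exists_eulerField_sub_mem_tangent (s k : ℕ) (a b : ℕ) (hab : (s + 1) * a + b = k + s) :
    ∃ ν : ℝ, (a ≤ s → s * (s + 1) < k → 0 < ν) ∧
      eulerField a b - ν • eulerField 0 (k + s) ∈ tangent s k := by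
  induction a generalizing b with
  | zero =>
    refine ⟨1, fun _ _ => one_pos, ?_⟩
    rw [mul_zero, zero_add] at hab
    rw [hab, one_smul, sub_self]
    exact Submodule.zero_mem _
  | succ a ih =>
    obtain ⟨ν, hν, h⟩ := ih (b + 1 + s) (by rw [← hab]; ring)
    have hrel := eulerField_relation_succ s a b
    have hk : (s + 1) * a + (b + 1) = k := by
      rw [Nat.mul_succ] at hab; omega
    rw [hk] at hrel
    refine ⟨((a : ℝ) + (b + 1) - s) / (b + 1) * ν, fun ha hsk => ?_, ?_⟩
    · have hpos := hν (by omega) hsk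
      have h1 : s * (s + 1) < (s + 1) * a + (b + 1) := hk ▸ hsk
      have h2 : (s + 1) * a ≤ s * (s + 1) := by
        rw [mul_comm]; exact Nat.mul_le_mul_right _ (by omega)
      -- Here b + 1 > (s+1)(s-a) ≥ s - a, by the lower bound on k.
      have h3 : s < a + (b + 1) := by
        obtain ⟨e, rfl⟩ := Nat.exists_eq_add_of_le ha
        nlinarith
      have h3' : (s : ℝ) < (a : ℝ) + (b + 1) := by exact_mod_cast h3
      have : (0 : ℝ) < (a : ℝ) + (b + 1) - s := by linarith
      positivity
    · have hb : (b : ℝ) + 1 ≠ 0 := by positivity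
      have := Submodule.sub_mem _
        (Submodule.smul_mem _ (((a : ℝ) + (b + 1) - s) / (b + 1)) h)
        (Submodule.smul_mem _ ((b : ℝ) + 1)⁻¹ hrel)
      convert this using 1
      match_scalars <;> field_simp
      ring

/-- The chain ends at x^K y^s E, which is tangent because (K-s) x^K y^s E comes from the bracket of
x^K E with the leading field. Climbing back only divides by a + (s+1)j + 1 > 0. For K = s the
argument fails because x^s E commutes with the leading field. -/
theorem eulerField_mem_tangent_of_ne {s K : ℕ} (hK : K ≠ s) (j a : ℕ) (ha : a + j = K) :
    eulerField a ((s + 1) * j + s) ∈ tangent s ((s + 1) * K) := by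
  induction j generalizing a with
  | zero =>
    rw [add_zero] at ha
    subst ha
    have hne : (a : ℝ) - s ≠ 0 := by rw [sub_ne_zero]; exact_mod_cast hK
    have := Submodule.smul_mem _ ((a : ℝ) - s)⁻¹ (eulerField_relation_zero s a)
    rw [mul_zero, zero_add]
    rwa [smul_smul, inv_mul_cancel₀ hne, one_smul] at this
  | succ j ih =>
    have h := ih (a + 1) (by omega)
    have hrel := eulerField_relation_succ s a ((s + 1) * j + s)
    have e1 : (s + 1) * a + ((s + 1) * j + s + 1) = (s + 1) * K := by rw [← ha]; ring
    have e2 : (s + 1) * (j + 1) + s = (s + 1) * j + s + 1 + s := by ring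
    rw [e1] at hrel
    rw [e2]
    push_cast at hrel
    have hc : (0 : ℝ) < (a : ℝ) + (((s : ℝ) + 1) * j + s + 1) - s := by
      have : (a : ℝ) + (((s : ℝ) + 1) * j + s + 1) - s = a + ((s : ℝ) + 1) * j + 1 := by ring
      rw [this]; positivity
    have := Submodule.smul_mem _ ((a : ℝ) + (((s : ℝ) + 1) * j + s + 1) - s)⁻¹
      (Submodule.add_mem _ hrel (Submodule.smul_mem _ ((((s : ℝ) + 1) * j + s) + 1) h))
    rwa [sub_add_cancel, smul_smul, inv_mul_cancel₀ hc.ne', one_smul] at this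

theorem xField_mem_tangent {s K : ℕ} (hK : K ≠ s) (hK0 : 1 ≤ K) :
    xField (2 * s + (s + 1) * K + 1) ∈ tangent s ((s + 1) * K) := by
  obtain ⟨μ, -, h⟩ := exists_xField_sub_mem_tangent s (k := (s + 1) * K)
    (Nat.mul_pos (Nat.succ_pos s) hK0)
  have := Submodule.add_mem _ h
    (Submodule.smul_mem _ μ (eulerField_mem_tangent_of_ne hK K 0 (zero_add K)))
  rwa [sub_add_cancel] at this

/-- It suffices to reach every monomial field of relative degree k. The fields x^a y^b E and
y^(s+k+1) ∂/∂y come from the relations above, the ∂/∂y monomials divisible by x from time rescaling,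
and the ∂/∂x monomials divisible by x by subtracting a ∂/∂y monomial from an Euler field. -/
theorem exists_add_smul_xField_mem (s : ℕ) {k : ℕ} (hk : 1 ≤ k) {R : FormalVectorField}
    (hR : R ∈ vord s (s + k)) :
    ∃ c : ℝ, ∃ U ∈ tangent s k, R - c • xField (2 * s + k + 1) - U ∈ vord s (s + k + 1) := by
  let S : Submodule ℝ FormalVectorField :=
    (tangent s k ⊔ Submodule.span ℝ {xField (2 * s + k + 1)}) ⊔ vord s (s + k + 1)
  have hT : ∀ U ∈ tangent s k, U ∈ S := fun U hU =>
    Submodule.mem_sup_left (Submodule.mem_sup_left hU)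
  have hp : xField (2 * s + k + 1) ∈ S :=
    Submodule.mem_sup_left (Submodule.mem_sup_right (Submodule.mem_span_singleton_self _))
  have hk' : (0 : ℝ) < k := by exact_mod_cast hk
  obtain ⟨μ, hμ, hμT⟩ := exists_xField_sub_mem_tangent s hk
  have he0 : eulerField 0 (k + s) ∈ S := by
    have := S.smul_mem μ⁻¹ (S.sub_mem hp (hT _ hμT))
    rwa [sub_sub_cancel, smul_smul, inv_mul_cancel₀ hμ, one_smul] at this
  have he : ∀ a b, (s + 1) * a + b = k + s → eulerField a b ∈ S := by
    intro a b hab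
    obtain ⟨ν, -, hν⟩ := exists_eulerField_sub_mem_tangent s k a b hab
    have := S.add_mem (hT _ hν) (S.smul_mem ν he0)
    rwa [sub_add_cancel] at this
  have hq : yField (s + k + 1) ∈ S := by
    have := S.smul_mem (k : ℝ)⁻¹
      (S.add_mem (hT _ (yField_relation s k)) (S.smul_mem ((s : ℝ) + k + 1) he0))
    rwa [sub_add_cancel, smul_smul, inv_mul_cancel₀ hk'.ne', one_smul] at this
  have hy : ∀ a b, (s + 1) * a + b = s + k + 1 →
      (![0, X 0 ^ a * X 1 ^ b] : FormalVectorField) ∈ S := by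
    intro a b hab
    cases a with
    | zero =>
      have : b = s + k + 1 := by omega
      subst this
      rw [pow_zero, one_mul]
      exact hq
    | succ a =>
      have hg : (X 0 ^ a * X 1 ^ b : Series) ∈ ord s k :=
        monomial_mem_ord a b (by rw [Nat.mul_succ] at hab; omega)
      have h1 : (X 0 ^ a * X 1 ^ b : Series) • leadingField s ∈ tangent s k := by
        have := mem_tangent (s := s) (k := k) (Submodule.zero_mem _) hg (by simp)
        rwa [show bracket 0 (leadingField s) = 0 by
          ext1 i; simp [bracket, lieD_apply], add_zero] at this
      have := S.sub_mem (he a (b + s) (by rw [Nat.mul_succ] at hab; omega)) (hT _ h1)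
      convert this using 1
      ext1 i
      fin_cases i <;> simp [eulerField, leadingField] <;> ring
  have hx : ∀ a b, (s + 1) * a + b = s + k + s + 1 →
      (![X 0 ^ a * X 1 ^ b, 0] : FormalVectorField) ∈ S := by
    intro a b hab
    cases a with
    | zero =>
      have : b = 2 * s + k + 1 := by omega
      subst this
      rw [pow_zero, one_mul]
      exact hp
    | succ a =>
      have := S.sub_mem (he a b (by rw [Nat.mul_succ] at hab; omega))
        (hy a (b + 1) (by rw [Nat.mul_succ] at hab; omega))
      convert this using 1
      ext1 i
      fin_cases i <;> simp [eulerField]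
  have hRS : R ∈ S := by
    have h0 : (![R 0, 0] : FormalVectorField) ∈ S := by
      let L : Series →ₗ[ℝ] FormalVectorField := LinearMap.single ℝ (fun _ => Series) 0
      have hL : ∀ f, L f = ![f, 0] := fun f => by
        ext1 i; fin_cases i <;> simp [L]
      rw [← hL]
      refine mem_of_mem_ord (s := s) (n := s + k + s + 1) (N := s + k + 1 + s + 1) (S.comap L)
        ?_ ?_ hR.1
      · intro a b h1 h2
        rw [Submodule.mem_comap, hL]
        exact hx a b (by omega)
      · intro f hf
        rw [Submodule.mem_comap, hL]
        exact Submodule.mem_sup_right ⟨hf, Ideal.zero_mem _⟩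
    have h1 : (![0, R 1] : FormalVectorField) ∈ S := by
      let L : Series →ₗ[ℝ] FormalVectorField := LinearMap.single ℝ (fun _ => Series) 1
      have hL : ∀ f, L f = ![0, f] := fun f => by
        ext1 i; fin_cases i <;> simp [L]
      rw [← hL]
      refine mem_of_mem_ord (s := s) (n := s + k + 1) (N := s + k + 1 + 1) (S.comap L)
        ?_ ?_ hR.2
      · intro a b h1 h2
        rw [Submodule.mem_comap, hL]
        exact hy a b (by omega)
      · intro f hf
        rw [Submodule.mem_comap, hL]
        exact Submodule.mem_sup_right ⟨Ideal.zero_mem _, hf⟩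
    have := S.add_mem h0 h1
    convert this using 1
    ext1 i
    fin_cases i <;> simp
  obtain ⟨A, hA, B, hB, hAB⟩ := Submodule.mem_sup.1 hRS
  obtain ⟨U, hU, P, hP, hUP⟩ := Submodule.mem_sup.1 hA
  obtain ⟨c, rfl⟩ := Submodule.mem_span_singleton.1 hP
  refine ⟨c, U, hU, ?_⟩
  rw [← hAB, ← hUP]
  convert hB using 1
  abel

/-- Because x^s E commutes with V₀, the Jacobi identity sends gV₀ + [Z, V₀] to (x^s E)(g) V₀ + [[x^s
E, Z], V₀]. -/
theorem bracket_eulerField_tangent {s k : ℕ} (hk : 1 ≤ k) {U : FormalVectorField}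
    (hU : U ∈ tangent s k) :
    bracket (eulerField s 0) U ∈ tangent s (k + s * (s + 1)) := by
  obtain ⟨Z, hZ, g, hg, -, rfl⟩ := hU
  have hE : eulerField s 0 ∈ vord s (s * (s + 1)) :=
    eulerField_mem_vord (by rw [mul_comm]; omega)
  have hb := bracket_mem_vord hE hZ
  rw [bracket_add_right, bracket_smul_series_right, bracket_jacobi,
    bracket_eulerField_self_leadingField, smul_zero, add_zero,
    show bracket Z 0 = 0 by ext1 i; simp [bracket, lieD_apply], add_zero]
  rw [add_comm (s * (s + 1))] at hb
  refine mem_tangent hb (lieD_mem_ord hE hg) (hb.2 _ ?_)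
  simp [wt]
  nlinarith

/-- The bracket of `x^s (x ∂/∂x + y ∂/∂y)` with `y^(2s+k+1) ∂/∂x` is transversal to the tangent
space. -/
theorem exists_bracket_eulerField_xField (s : ℕ) {k : ℕ} (hk : 1 ≤ k) :
    ∃ ν : ℝ, ν ≠ 0 ∧ bracket (eulerField s 0) (xField (2 * s + k + 1)) -
      ν • xField (2 * s + (k + s * (s + 1)) + 1) ∈ tangent s (k + s * (s + 1)) := by
  have hk' : (k : ℝ) ≠ 0 := by exact_mod_cast (by omega : k ≠ 0)
  obtain ⟨μ, hμ, hT⟩ := exists_xField_sub_mem_tangent s hk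
  obtain ⟨μ', hμ', hT'⟩ := exists_xField_sub_mem_tangent s (k := k + s * (s + 1)) (by omega)
  obtain ⟨ν, hν, hTν⟩ := exists_eulerField_sub_mem_tangent s (k + s * (s + 1)) s (k + s) (by ring)
  have hν0 := (hν le_rfl (by omega)).ne'
  have h := bracket_eulerField_tangent hk hT
  rw [sub_eq_add_neg, bracket_add_right, ← neg_smul, bracket_smul_right,
    bracket_eulerField_eulerField, zero_add] at h
  push_cast at h
  have e : (0 : ℝ) + (k + s) - s = k := by ring
  rw [e] at h
  -- Pass to μ y^(k+s) E, where the bracket contributes the factor k; lower x^s y^(k+s) E to a pure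
  -- power of y (factor ν, nonzero in this degree); return to a ∂/∂x monomial by dividing by μ'.
  refine ⟨μ * k * ν / μ', div_ne_zero (mul_ne_zero (mul_ne_zero hμ hk') hν0) hμ', ?_⟩
  have := Submodule.sub_mem _ (Submodule.add_mem _ h (Submodule.smul_mem _ (μ * k) hTν))
    (Submodule.smul_mem _ (μ * k * ν / μ') hT')
  convert this using 1
  match_scalars <;> field_simp <;> ring

/-! ### One normalization step -/

/-- The effect of a transformation close to the identity, up to terms of higher degree. -/
theorem exists_transforms_add {s p k M : ℕ} {V U : FormalVectorField}
    (hV : V - leadingField s ∈ vord s (s + p)) (hU : U ∈ tangent s k) (hk : 1 ≤ k)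
    (hMp : M ≤ k + p) (hMk : M ≤ 2 * k) :
    ∃ (φ : Fin 2 → Series) (T : Series) (w : FormalVectorField), IsNearIdentity φ ∧
      φ - X ∈ vord s k ∧ T - 1 ∈ ord s k ∧ Transforms φ T V w ∧
      w - (V + U) ∈ vord s (s + M) := by
  have hU' := tangent_le_vord s k hU
  obtain ⟨Y, hY, g, hg, hl, rfl⟩ := hU
  set V₀ := leadingField s
  have hVs : V ∈ vord s s := by
    have := Submodule.add_mem _ (vord_anti s (by omega) hV) (leadingField_mem_vord s)
    rwa [sub_add_cancel] at this
  let φ : Fin 2 → Series := (X : Fin 2 → Series) + Y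
  have hφ : φ - X = Y := by simp [φ]
  have hφX : ∀ i, φ i = X i + Y i := fun i => rfl
  have hφY : φ - X ∈ vord s k := by rwa [hφ]
  have hnear : IsNearIdentity φ := isNearIdentity_of_mem_vord hk hφY (by
    classical
    rw [hφX, map_add, hl, coeff_X, if_neg (by simp [Finsupp.single_left_inj]), add_zero])
  obtain ⟨w, hw⟩ := exists_transforms (isStateChange_of_isNearIdentity hnear) (1 + g) V
  refine ⟨φ, 1 + g, w, hnear, hφY, by simpa using hg, hw, ?_⟩
  rw [transforms_iff] at hw
  refine mem_vord_of_lieD (isStateChange_of_isNearIdentity hnear) (near_mem_ord hφY).1 ?_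
  have hA : (fun i => subst φ (V i) - V i - lieD (φ - X) (V i)) ∈ vord s (s + 2 * k) :=
    ⟨ord_anti s (by omega) (subst_sub_sub_lieD_mem_ord hφY hVs.1),
      ord_anti s (by omega) (subst_sub_sub_lieD_mem_ord hφY hVs.2)⟩
  have hσ : (fun i => subst φ (V i) - V i) ∈ vord s (s + k) :=
    ⟨ord_anti s (by omega) (subst_sub_mem_ord hφY hVs.1),
      ord_anti s (by omega) (subst_sub_mem_ord hφY hVs.2)⟩
  have hB := lieD_comp_mem_vord hY hV
  have hC₁ := smul_mem_vord hg hσ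
  have hC₂ := smul_mem_vord hg hV
  have hD := lieD_comp_mem_vord hV hY
  have hE := lieD_comp_mem_vord hU' hY
  -- Once the infinitesimal action is subtracted, each term is either quadratic in (Y, g), of
  -- relative order 2k, or pairs (Y, g) with V - V₀, of relative order k + p.
  have key : (fun i => lieD (w - (V + (g • V₀ + bracket Y V₀))) (φ i)) =
      (fun i => subst φ (V i) - V i - lieD (φ - X) (V i)) + (fun i => lieD Y ((V - V₀) i))
      + (g • fun i => subst φ (V i) - V i) + g • (V - V₀) - (fun i => lieD (V - V₀) (Y i))
      - (fun i => lieD (g • V₀ + bracket Y V₀) (Y i)) := by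
    ext1 i
    simp only [Pi.add_apply, Pi.sub_apply, Pi.smul_apply, smul_eq_mul]
    rw [lieD_sub_left, hw, hφX, map_add, lieD_X, lieD_add_left V, hφ]
    simp only [map_sub, lieD_sub_left, Pi.add_apply, Pi.smul_apply, smul_eq_mul]
    simp only [bracket.eq_def Y V₀]
    ring
  rw [key]
  refine Submodule.sub_mem _ (Submodule.sub_mem _ (Submodule.add_mem _ (Submodule.add_mem _
    (Submodule.add_mem _ (vord_anti s ?_ hA) (vord_anti s ?_ hB)) (vord_anti s ?_ hC₁))
    (vord_anti s ?_ hC₂)) (vord_anti s ?_ hD)) (vord_anti s ?_ hE) <;> omega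

/-! ### Orbital forms, iteration and passage to the limit -/

theorem coeff_seriesInY (c : ℕ → ℝ) (d : Fin 2 →₀ ℕ) :
    coeff d (seriesInY c) = if d 0 = 0 then c (d 1) else 0 := rfl

theorem seriesInY_mem_ord {s n : ℕ} {c : ℕ → ℝ} (hc : ∀ i < n, c i = 0) :
    seriesInY c ∈ ord s n := by
  intro d hd
  rw [coeff_seriesInY]
  split_ifs with h
  · exact hc _ (by simpa [wt, h] using hd)
  · rfl

theorem seriesInY_sub (c d : ℕ → ℝ) : seriesInY (c - d) = seriesInY c - seriesInY d := by
  ext e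
  simp only [map_sub, coeff_seriesInY, Pi.sub_apply]
  split_ifs <;> simp

theorem seriesInY_single (n : ℕ) (r : ℝ) : seriesInY (Pi.single n r) = r • X 1 ^ n := by
  ext e
  have h := coeff_monomial_pow 0 n e
  rw [pow_zero, one_mul] at h
  rw [coeff_seriesInY, map_smul, h]
  by_cases h0 : e 0 = 0 <;> by_cases h1 : e 1 = n <;> simp [h0, h1]

theorem orbitalForm_sub_orbitalForm (s : ℕ) (α β : ℕ → ℝ) :
    orbitalForm s α - orbitalForm s β = ![X 1 * seriesInY (α - β), 0] := by
  ext1 i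
  fin_cases i
  · simp [orbitalForm, seriesInY_sub]; ring
  · simp [orbitalForm]

theorem orbitalForm_sub_mem_vord {s k : ℕ} {α β : ℕ → ℝ} (h : ∀ i < 2 * s + k, α i = β i) :
    orbitalForm s α - orbitalForm s β ∈ vord s (s + k) := by
  rw [orbitalForm_sub_orbitalForm]
  refine ⟨ord_anti s ?_ (mul_mem_ord (X_one_mem_ord s) (seriesInY_mem_ord (n := 2 * s + k) ?_)),
    Ideal.zero_mem _⟩
  · omega
  · intro i hi; rw [Pi.sub_apply, h i hi, sub_self]

theorem orbitalForm_zero (s : ℕ) : orbitalForm s 0 = leadingField s := by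
  have : seriesInY 0 = 0 := by ext d; simp [coeff_seriesInY]
  ext1 i
  fin_cases i <;> simp [orbitalForm, leadingField, this]

theorem orbitalForm_sub_leadingField_mem_vord {s k : ℕ} {α : ℕ → ℝ}
    (h : ∀ i < 2 * s + k, α i = 0) : orbitalForm s α - leadingField s ∈ vord s (s + k) := by
  rw [← orbitalForm_zero]
  exact orbitalForm_sub_mem_vord h

theorem orbitalForm_update (s : ℕ) (α : ℕ → ℝ) (n : ℕ) (c : ℝ) :
    orbitalForm s (Function.update α n c) = orbitalForm s α + (c - α n) • xField (n + 1) := by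
  rw [← sub_eq_iff_eq_add', orbitalForm_sub_orbitalForm,
    show Function.update α n c - α = Pi.single n (c - α n) by
      ext i; by_cases h : i = n
      · subst h; simp
      · simp [h], seriesInY_single]
  ext1 i
  fin_cases i <;> simp [xField, pow_succ']

theorem exists_seq {β : Type*} (P : ℕ → β → Prop) (R : ℕ → β → β → Prop) (h0 : ∃ a, P 0 a)
    (h : ∀ n a, P n a → ∃ b, P (n + 1) b ∧ R n a b) :
    ∃ f : ℕ → β, ∀ n, P n (f n) ∧ R n (f n) (f (n + 1)) := by
  choose next hP hR using h
  obtain ⟨a, ha⟩ := h0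
  let F : ∀ n, {b // P n b} := fun n =>
    Nat.rec ⟨a, ha⟩ (fun n b => ⟨next n b.1 b.2, hP n b.1 b.2⟩) n
  exact ⟨fun n => (F n).1, fun n => ⟨(F n).2, hR n _ (F n).2⟩⟩

/-- The transformation `(Φ, T)` brings `V` to a field `w` that agrees with `orbitalForm s α` up to
relative degree `k`. -/
structure IsApproxReduction (s k₀ : ℕ) (V : FormalVectorField) (α₀ : ℕ → ℝ) (k : ℕ)
    (Φ : Fin 2 → Series) (T : Series) (w : FormalVectorField) (α : ℕ → ℝ) : Prop where
  near : IsNearIdentity Φ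
  mem_ord : Φ 0 ∈ ord s (s + 1) ∧ Φ 1 ∈ ord s 1
  time : constantCoeff T = 1
  transforms : Transforms Φ T V w
  sub_mem : w - orbitalForm s α ∈ vord s (s + k)
  eq_zero : ∀ i, 2 * s + k ≤ i → α i = 0
  eq_of_lt : ∀ i < 2 * s + k₀, α i = α₀ i
  resonant : ∀ K, K ≠ s → 2 * s + k₀ ≤ K * (s + 1) + 2 * s → α (K * (s + 1) + 2 * s) = 0

/-- In the degrees (s+1)K with K ≠ s, the leftover multiple of y^(2s+k+1) ∂/∂x is itself tangent and
is absorbed into U, so c = 0 can be taken. -/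
theorem exists_normalizing (s : ℕ) {k : ℕ} (hk : 1 ≤ k) {R : FormalVectorField}
    (hR : R ∈ vord s (s + k)) :
    ∃ c : ℝ, (∀ K, K ≠ s → 2 * s + k = K * (s + 1) + 2 * s → c = 0) ∧
      ∃ U ∈ tangent s k, R - c • xField (2 * s + k + 1) - U ∈ vord s (s + k + 1) := by
  obtain ⟨c, U, hU, h⟩ := exists_add_smul_xField_mem s hk hR
  by_cases hK : ∃ K, K ≠ s ∧ 2 * s + k = K * (s + 1) + 2 * s
  · obtain ⟨K, hKs, hKk⟩ := hK
    have hkK : k = (s + 1) * K := by rw [mul_comm]; omega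
    have hK0 : 1 ≤ K := by
      rcases Nat.eq_zero_or_pos K with h0 | h0
      · rw [h0, mul_zero] at hkK; omega
      · exact h0
    refine ⟨0, fun _ _ _ => rfl, U + c • xField (2 * s + k + 1), ?_, ?_⟩
    · rw [hkK] at hU ⊢
      exact Submodule.add_mem _ hU (Submodule.smul_mem _ _ (xField_mem_tangent hKs hK0))
    · convert h using 1
      rw [zero_smul]; abel
  · push Not at hK
    exact ⟨c, fun K hKs hKk => absurd hKk (hK K hKs), U, hU, h⟩

theorem IsApproxReduction.step {s k₀ k : ℕ} {V w : FormalVectorField} {α₀ α : ℕ → ℝ}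
    {Φ : Fin 2 → Series} {T : Series} (hα₀ : ∀ i ≤ 2 * s, α₀ i = 0) (hk₀ : 1 ≤ k₀) (hk : k₀ ≤ k)
    (h : IsApproxReduction s k₀ V α₀ k Φ T w α) :
    ∃ Φ' T' w' α', IsApproxReduction s k₀ V α₀ (k + 1) Φ' T' w' α' ∧
      (∀ i, Φ' i - Φ i ∈ ord s k) ∧ T' - T ∈ ord s k ∧ ∀ i < 2 * s + k, α' i = α i := by
  obtain ⟨c, hc, U, hU, hR⟩ := exists_normalizing s (hk₀.trans hk) h.sub_mem
  have hα : ∀ i < 2 * s + 1, α i = 0 := fun i hi => by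
    rw [h.eq_of_lt i (by omega), hα₀ i (by omega)]
  have hw : w - leadingField s ∈ vord s (s + 1) := by
    have := Submodule.add_mem _ (vord_anti s (by omega) h.sub_mem)
      (orbitalForm_sub_leadingField_mem_vord hα)
    rwa [sub_add_sub_cancel] at this
  obtain ⟨ψ, S, w', hψ, hψX, hS, htr, hw'⟩ := exists_transforms_add hw
    (Submodule.neg_mem _ hU) (hk₀.trans hk) (le_refl (k + 1)) (by omega)
  have hψo := near_mem_ord hψX
  have hS1 : constantCoeff S = 1 := by
    have := constantCoeff_eq_zero_of_mem_ord (by omega) hS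
    rwa [map_sub, map_one, sub_eq_zero] at this
  refine ⟨comp Φ ψ, subst ψ T * S, w', Function.update α (2 * s + k) c,
    ⟨isNearIdentity_comp h.near hψ, ⟨subst_mem_ord hψo.1 hψo.2 h.mem_ord.1,
      subst_mem_ord hψo.1 hψo.2 h.mem_ord.2⟩, ?_, transforms_comp h.near.1 hψ.1 h.transforms htr,
      ?_, ?_, ?_, ?_⟩, ?_, ?_, ?_⟩
  · rw [map_mul, constantCoeff_subst_eq hψ.1, h.time, hS1, mul_one]
  · rw [orbitalForm_update, h.eq_zero _ le_rfl, sub_zero]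
    have := Submodule.add_mem _ hw' hR
    convert this using 1
    abel
  · intro i hi
    rw [Function.update_of_ne (by omega), h.eq_zero i (by omega)]
  · intro i hi
    rw [Function.update_of_ne (by omega), h.eq_of_lt i hi]
  · intro K hKs hK
    by_cases hKk : K * (s + 1) + 2 * s = 2 * s + k
    · rw [hKk, Function.update_self]
      exact hc K hKs hKk.symm
    · rw [Function.update_of_ne hKk, h.resonant K hKs hK]
  · intro i
    exact ord_anti s (by omega) (subst_sub_mem_ord hψX (mem_ord_zero s (Φ i)))
  · have e : subst ψ T * S - T = (subst ψ T - T) * S + T * (S - 1) := by ring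
    rw [e]
    exact Ideal.add_mem _ (Ideal.mul_mem_right _ _
      (ord_anti s (by omega) (subst_sub_mem_ord hψX (mem_ord_zero s T))))
      (Ideal.mul_mem_left _ _ hS)
  · intro i hi
    rw [Function.update_of_ne (by omega)]

/-- Order s + 2 suffices because the linear monomials have weights s + 1 and 1. -/
theorem isNearIdentity_of_sub_mem_ord {s : ℕ} {φ ψ : Fin 2 → Series} (hψ : IsNearIdentity ψ)
    (h : ∀ i, φ i - ψ i ∈ ord s (s + 2)) : IsNearIdentity φ := by
  have key : ∀ i d, wt s d < s + 2 → coeff d (φ i) = coeff d (ψ i) := fun i d hd => by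
    have := h i d hd
    rwa [map_sub, sub_eq_zero] at this
  refine ⟨fun i => ?_, ?_⟩
  · rw [← coeff_zero_eq_constantCoeff_apply, key i 0 (by simp [wt]),
      coeff_zero_eq_constantCoeff_apply, hψ.1]
  · rw [← hψ.2]
    ext i j
    exact key i _ (by fin_cases j <;> simp [wt])

/-- Reduction to the orbital form by infinitely many steps, starting at relative degree `k₀`. -/
theorem exists_transforms_orbitalForm {s k₀ : ℕ} (hk₀ : 1 ≤ k₀) {V : FormalVectorField}
    {α₀ : ℕ → ℝ} (hα₀ : ∀ i ≤ 2 * s, α₀ i = 0) (hα₀' : ∀ i, 2 * s + k₀ ≤ i → α₀ i = 0)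
    (hV : V - orbitalForm s α₀ ∈ vord s (s + k₀)) :
    ∃ (φ : Fin 2 → Series) (T : Series) (α : ℕ → ℝ), IsNearIdentity φ ∧ constantCoeff T = 1 ∧
      Transforms φ T V (orbitalForm s α) ∧ (∀ i < 2 * s + k₀, α i = α₀ i) ∧
      ∀ K, K ≠ s → 2 * s + k₀ ≤ K * (s + 1) + 2 * s → α (K * (s + 1) + 2 * s) = 0 := by
  have hXid : IsNearIdentity (X : Fin 2 → Series) :=
    isNearIdentity_of_mem_vord (s := s) le_rfl (by rw [sub_self]; exact Submodule.zero_mem _)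
      (by classical rw [coeff_X, if_neg (by simp [Finsupp.single_left_inj])])
  obtain ⟨f, hf⟩ := exists_seq
    (β := (Fin 2 → Series) × Series × FormalVectorField × (ℕ → ℝ))
    (fun n a => IsApproxReduction s k₀ V α₀ (k₀ + n) a.1 a.2.1 a.2.2.1 a.2.2.2)
    (fun n a b => (∀ i, b.1 i - a.1 i ∈ ord s (k₀ + n)) ∧ b.2.1 - a.2.1 ∈ ord s (k₀ + n) ∧
      ∀ i < 2 * s + (k₀ + n), b.2.2.2 i = a.2.2.2 i)
    ⟨(X, 1, V, α₀), ⟨hXid, ⟨X_zero_mem_ord s, X_one_mem_ord s⟩, map_one _, by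
      rw [transforms_iff]
      intro i
      rw [lieD_X, subst_self, one_mul, id], hV, hα₀', fun _ _ => rfl, fun K _ hK => hα₀' _ hK⟩⟩
    (by
      rintro n ⟨Φ, T, w, α⟩ h
      obtain ⟨Φ', T', w', α', h', hh⟩ := h.step hα₀ hk₀ (by omega)
      exact ⟨(Φ', T', w', α'), h', hh⟩)
  choose Φ hΦ using fun i => exists_limit (s := s) (fun n => (f n).1 i) fun n =>
    ord_anti s (by omega) ((hf n).2.1 i)
  obtain ⟨T, hT⟩ := exists_limit (s := s) (fun n => (f n).2.1) fun n =>
    ord_anti s (by omega) (hf n).2.2.1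
  -- Step n changes only the coefficient of index 2s + k₀ + n, so coefficient i is already final at
  -- step i.
  let α : ℕ → ℝ := fun i => (f i).2.2.2 i
  have hα : ∀ n i, i < 2 * s + (k₀ + n) → α i = (f n).2.2.2 i := by
    have hstep : ∀ m n i, m ≤ n → i < 2 * s + (k₀ + m) → (f n).2.2.2 i = (f m).2.2.2 i := by
      intro m n i hmn hi
      induction n, hmn using Nat.le_induction with
      | base => rfl
      | succ n hmn ih => rw [(hf n).2.2.2 i (by omega), ih]
    intro n i hi
    rcases le_total n i with h | h
    · exact hstep n i i h hi
    · exact (hstep i n i h (by omega)).symm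
  have hnear : IsNearIdentity Φ :=
    isNearIdentity_of_sub_mem_ord (s := s) (hf (s + 2)).1.near fun i => hΦ i (s + 2)
  have hΦo : Φ 0 ∈ ord s (s + 1) ∧ Φ 1 ∈ ord s 1 := by
    refine ⟨?_, ?_⟩
    · have := Ideal.add_mem _ (hΦ 0 (s + 1)) (hf (s + 1)).1.mem_ord.1
      rwa [sub_add_cancel] at this
    · have := Ideal.add_mem _ (hΦ 1 1) (hf 1).1.mem_ord.2
      rwa [sub_add_cancel] at this
  refine ⟨Φ, T, α, hnear, ?_, ?_, ?_, ?_⟩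
  · have := constantCoeff_eq_zero_of_mem_ord one_ne_zero (hT 1)
    rw [map_sub, sub_eq_zero] at this
    rw [this, (hf 1).1.time]
  · rw [transforms_iff]
    intro i
    rw [← sub_eq_zero]
    refine eq_zero_of_forall_mem_ord (s := s) fun n => ?_
    have h := (hf n).1
    have htr := (transforms_iff.1 h.transforms) i
    set w := (f n).2.2.1
    set Φn := (f n).1
    set Tn := (f n).2.1
    -- The limit equation is compared with the exact equation at stage n; each of the four
    -- differences has order at least n.
    have e : lieD (orbitalForm s α) (Φ i) - T * subst Φ (V i) =
        lieD (orbitalForm s α) (Φ i - Φn i) + lieD (orbitalForm s α - w) (Φn i)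
        - (T - Tn) * subst Φ (V i) - Tn * (subst Φ (V i) - subst Φn (V i)) := by
      rw [lieD_sub_left, htr, map_sub]; ring
    have h1 : orbitalForm s α - leadingField s ∈ vord s (s + 0) :=
      orbitalForm_sub_leadingField_mem_vord fun i hi => by
        rw [hα 0 i (by omega), (hf 0).1.eq_of_lt i (by omega), hα₀ i (by omega)]
    have h2 : orbitalForm s α ∈ vord s s := by
      have := Submodule.add_mem _ h1 (leadingField_mem_vord s)
      rwa [sub_add_cancel] at this
    have h3 : orbitalForm s α - w ∈ vord s (s + (k₀ + n)) := by
      have := Submodule.sub_mem _ (orbitalForm_sub_mem_vord (hα n)) h.sub_mem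
      rwa [sub_sub_sub_cancel_right] at this
    rw [e]
    refine Ideal.sub_mem _ (Ideal.sub_mem _ (Ideal.add_mem _ ?_ ?_) ?_) ?_
    · exact ord_anti s (by omega) (lieD_mem_ord h2 (hΦ i n))
    · exact ord_anti s (by omega) (lieD_mem_ord h3 (mem_ord_zero s _))
    · exact Ideal.mul_mem_right _ _ (hT n)
    · exact Ideal.mul_mem_left _ _
        (subst_sub_subst_mem_ord hΦo h.mem_ord (fun j => hΦ j n) _)
  · intro i hi
    rw [hα 0 i (by omega), (hf 0).1.eq_of_lt i hi]
  · intro K hKs hK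
    rw [hα _ _ (show K * (s + 1) + 2 * s < 2 * s + (k₀ + (K * (s + 1) + 2 * s)) by omega)]
    exact (hf _).1.resonant K hKs hK

/-! ### The exact symmetry of the leading field -/

theorem binomialSeries_pow (r : ℝ) (n : ℕ) :
    PowerSeries.binomialSeries ℝ r ^ n = PowerSeries.binomialSeries ℝ (n * r) := by
  induction n with
  | zero => simp
  | succ n ih =>
    rw [pow_succ, ih, ← PowerSeries.binomialSeries_add]
    congr 1
    push_cast; ring

/-- p is the binomial series (1 - s c x^s)^(1/s), obtained by substituting into a one-variable
series. Its reciprocal is the factor by which the time-one flow of c x^s E multiplies x and y. -/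
theorem exists_root {s : ℕ} (hs : 1 ≤ s) (c : ℝ) :
    ∃ p G : Series, p ^ s = 1 - ((s : ℝ) * c) • X 0 ^ s ∧
      p = 1 - c • X 0 ^ s + X 0 ^ (2 * s) * G := by
  have hs0 : (s : ℝ) ≠ 0 := by exact_mod_cast (by omega : s ≠ 0)
  set B : PowerSeries ℝ := PowerSeries.binomialSeries ℝ ((s : ℝ)⁻¹)
  have hB : B ^ s = 1 + PowerSeries.X := by
    rw [binomialSeries_pow, mul_inv_cancel₀ hs0]
    simpa using PowerSeries.binomialSeries_nat (R := ℝ) (A := ℝ) 1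
  obtain ⟨G, hG⟩ : PowerSeries.X ^ 2 ∣ B - 1 - PowerSeries.C ((s : ℝ)⁻¹) * PowerSeries.X := by
    rw [PowerSeries.X_pow_dvd_iff]
    intro m hm
    interval_cases m
    · simp [B]
    · simp [B, PowerSeries.coeff_one]
  let a : Series := (-((s : ℝ) * c)) • X 0 ^ s
  have ha : PowerSeries.HasSubst a := by
    apply PowerSeries.HasSubst.of_constantCoeff_zero
    simp [a, smul_eq_C_mul]
    right; omega
  refine ⟨PowerSeries.subst a B, ((s : ℝ) * c) ^ 2 • PowerSeries.subst a G, ?_, ?_⟩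
  · rw [← PowerSeries.subst_pow ha, hB, PowerSeries.subst_add ha, PowerSeries.subst_X ha,
      ← PowerSeries.coe_substAlgHom ha, map_one]
    simp only [a, neg_smul]
    ring
  · have hB' : B = 1 + (s : ℝ)⁻¹ • PowerSeries.X + PowerSeries.X ^ 2 * G := by
      rw [← hG, PowerSeries.smul_eq_C_mul]; ring
    rw [hB', PowerSeries.subst_add ha, PowerSeries.subst_add ha, PowerSeries.subst_mul ha,
      PowerSeries.subst_smul ha, PowerSeries.subst_pow ha, PowerSeries.subst_X ha,
      ← PowerSeries.coe_substAlgHom ha, map_one]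
    simp only [a, neg_smul, smul_neg, smul_smul, inv_mul_cancel_left₀ hs0, neg_sq, smul_pow,
      ← pow_mul, smul_mul_assoc, mul_smul_comm, mul_comm s 2]
    ring

theorem lieD_leadingField_X_zero_pow (s n : ℕ) :
    lieD (leadingField s) (X 0 ^ n) = (n : ℝ) • (X 0 ^ n * X 1 ^ s) := by
  cases n with
  | zero => simp
  | succ n =>
    rw [lieD_X_pow]
    push_cast
    simp only [leadingField, Matrix.cons_val_zero]
    congr 1
    ring

/-- A series `u = 1 + c x^s + ...` solving the differential equation that makes
`(x u, y u)` a symmetry of the leading part. -/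
theorem exists_symmetry_factor {s : ℕ} (hs : 1 ≤ s) (c : ℝ) :
    ∃ u : Series, lieD (leadingField s) u = X 1 ^ s * (u ^ (s + 1) - u) ∧
      ∃ H : Series, u = 1 + c • X 0 ^ s + X 0 ^ (2 * s) * H := by
  obtain ⟨p, G, hp, hpG⟩ := exists_root hs c
  have hp1 : constantCoeff p ≠ 0 := by
    have h0 : (0 : ℝ) ^ s = 0 := zero_pow (by omega)
    have h1 : (0 : ℝ) ^ (2 * s) = 0 := zero_pow (by omega)
    rw [hpG]
    simp [smul_eq_C_mul, h0, h1]
  obtain ⟨u, hu⟩ := (MvPowerSeries.isUnit_iff_constantCoeff.2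
    (isUnit_iff_ne_zero.2 hp1)).exists_right_inv
  have hs0 : (s : ℝ) ≠ 0 := by exact_mod_cast (by omega : s ≠ 0)
  refine ⟨u, ?_, u * (C (c ^ 2) - (1 + c • X 0 ^ s) * G), ?_⟩
  · have h1 : p ^ s * lieD (leadingField s) p = (p ^ s - 1) * X 1 ^ s * p := by
      have h : p * lieD (leadingField s) (p ^ s) = (s : ℝ) • (p ^ s * lieD (leadingField s) p) := by
        obtain ⟨t, rfl⟩ : ∃ t, s = t + 1 := ⟨s - 1, by omega⟩
        rw [Derivation.leibniz_pow, Nat.add_sub_cancel, ← Nat.cast_smul_eq_nsmul ℝ,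
          mul_smul_comm, smul_eq_mul, pow_succ]
        congr 1; ring
      rw [hp, map_sub, lieD_one, Derivation.map_smul, lieD_leadingField_X_zero_pow] at h
      have h' := congrArg (fun f => (s : ℝ)⁻¹ • f) h
      simp only [smul_smul, inv_mul_cancel₀ hs0, one_smul] at h'
      rw [hp, ← h']
      simp only [smul_eq_C_mul, map_mul, map_natCast, zero_sub, mul_neg]
      have e : C ((s : ℝ)⁻¹) * (s : Series) = 1 := by
        rw [← map_natCast (C : ℝ →+* Series), ← map_mul, inv_mul_cancel₀ hs0, map_one]
      linear_combination (-p * s * C c * X 0 ^ s * X 1 ^ s) * e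
    have h2 : u * lieD (leadingField s) p + p * lieD (leadingField s) u = 0 := by
      have := congrArg (lieD (leadingField s)) hu
      rw [lieD_mul, lieD_one] at this
      linear_combination this
    have h3 : p ^ s * u ^ s = 1 := by rw [← mul_pow, hu, one_pow]
    have h4 : lieD (leadingField s) p = (1 - u ^ s) * X 1 ^ s * p := by
      linear_combination u ^ s * h1 - (lieD (leadingField s) p - X 1 ^ s * p) * h3
    linear_combination u * h2 - (lieD (leadingField s) u) * hu - u ^ 2 * h4
      - u * (1 - u ^ s) * X 1 ^ s * hu
  · rw [smul_eq_C_mul] at *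
    rw [map_pow]
    rw [mul_comm 2 s, pow_mul] at *
    linear_combination (1 + C c * X 0 ^ s) * hu - u * (1 + C c * X 0 ^ s) * hpG

/-- The time-one flow of `c x^s (x ∂/∂x + y ∂/∂y)` preserves the leading part and acts on the
remaining terms by the Lie bracket, up to terms of second order. -/
theorem exists_flow {s q : ℕ} (hs : 1 ≤ s) (c : ℝ) {W : FormalVectorField}
    (hW : W ∈ vord s (s + q)) :
    ∃ (φ : Fin 2 → Series) (w : FormalVectorField), IsNearIdentity φ ∧
      Transforms φ 1 (leadingField s + W) w ∧
      w - (leadingField s + W + c • bracket (eulerField s 0) W)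
        ∈ vord s (s + q + 2 * (s * (s + 1))) := by
  obtain ⟨u, hu, H, hH⟩ := exists_symmetry_factor hs c
  let φ : Fin 2 → Series := ![X 0 * u, X 1 * u]
  have hE : eulerField s 0 ∈ vord s (s * (s + 1)) :=
    eulerField_mem_vord (by rw [mul_comm]; omega)
  have hφE : φ - X - c • eulerField s 0 ∈ vord s (2 * (s * (s + 1))) := by
    have hx := mul_mem_ord (X_zero_mem_ord s)
      (Ideal.mul_mem_right H _ (pow_mem_ord (X_zero_mem_ord s) (2 * s)))
    have hy := mul_mem_ord (X_one_mem_ord s)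
      (Ideal.mul_mem_right H _ (pow_mem_ord (X_zero_mem_ord s) (2 * s)))
    refine ⟨?_, ?_⟩
    · convert ord_anti s ?_ hx using 1
      · change X 0 * u - X 0 - c • (X 0 ^ (s + 1) * X 1 ^ 0 : Series) = _
        rw [hH, smul_eq_C_mul, smul_eq_C_mul]; ring
      · exact le_of_eq (by ring)
    · convert ord_anti s ?_ hy using 1
      · change X 1 * u - X 1 - c • (X 0 ^ s * X 1 ^ (0 + 1) : Series) = _
        rw [hH, smul_eq_C_mul, smul_eq_C_mul]; ring
      · exact le_of_eq (by ring)
  have hφX : φ - X ∈ vord s (s * (s + 1)) := by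
    have := Submodule.add_mem _ (vord_anti s (by omega) hφE) (Submodule.smul_mem _ c hE)
    rwa [sub_add_cancel] at this
  have hκ : 1 ≤ s * (s + 1) := Nat.mul_pos hs (Nat.succ_pos s)
  have hnear : IsNearIdentity φ := isNearIdentity_of_mem_vord hκ hφX (by
    have := coeff_single_zero_mul_X_one u 0
    rwa [zero_add, pow_one, mul_comm] at this)
  have hsub : HasSubst φ := hasSubst_of_zero hnear.1
  -- The differential equation for u says precisely that (x u, y u) preserves the leading field.
  have hsym : ∀ i, subst φ (leadingField s i) = lieD (leadingField s) (φ i) := by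
    have e0 : φ 0 = X 0 * u := rfl
    have e1 : φ 1 = X 1 * u := rfl
    intro i
    fin_cases i
    · simp only [Fin.zero_eta]
      rw [e0, lieD_mul, hu, lieD_X]
      simp only [leadingField, Matrix.cons_val_zero]
      rw [subst_mul hsub, subst_pow hsub, subst_X hsub, subst_X hsub, e0, e1]
      ring
    · simp only [Fin.mk_one]
      rw [e1, lieD_mul, hu, lieD_X]
      simp only [leadingField, Matrix.cons_val_zero, Matrix.cons_val_one]
      rw [subst_add hsub, subst_pow hsub, subst_X hsub, ← coe_substAlgHom hsub, map_neg,
        coe_substAlgHom hsub, subst_X hsub, e0, e1]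
      ring
  obtain ⟨w, hw⟩ := exists_transforms (isStateChange_of_isNearIdentity hnear) 1
    (leadingField s + W)
  refine ⟨φ, w, hnear, hw, ?_⟩
  rw [transforms_iff] at hw
  refine mem_vord_of_lieD (isStateChange_of_isNearIdentity hnear) (near_mem_ord hφX).1 ?_
  set Y := eulerField s 0
  have hA : (fun i => subst φ (W i) - W i - lieD (φ - X) (W i)) ∈
      vord s (s + q + 2 * (s * (s + 1))) :=
    ⟨ord_anti s (by omega) (subst_sub_sub_lieD_mem_ord hφX hW.1),
      ord_anti s (by omega) (subst_sub_sub_lieD_mem_ord hφX hW.2)⟩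
  have hB := bracket_mem_vord hφE hW
  have hC := Submodule.smul_mem _ c (lieD_comp_mem_vord (bracket_mem_vord hE hW) hφX)
  have key : (fun i => lieD (w - (leadingField s + W + c • bracket Y W)) (φ i)) =
      (fun i => subst φ (W i) - W i - lieD (φ - X) (W i)) + bracket (φ - X - c • Y) W
      - c • (fun i => lieD (bracket Y W) ((φ - X : Fin 2 → Series) i)) := by
    ext1 i
    have hφi : φ i = X i + (φ - X : Fin 2 → Series) i := by simp
    simp only [Pi.add_apply, Pi.sub_apply, Pi.smul_apply, lieD_sub_left, lieD_add_left,
      lieD_smul_left, hw, one_mul, subst_add hsub, hsym, bracket.eq_def (φ - X - c • Y),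
      map_sub, lieD_X, Derivation.map_smul]
    simp only [bracket.eq_def Y W, smul_sub]
    ring
  rw [key]
  refine Submodule.sub_mem _ (Submodule.add_mem _ hA (vord_anti s ?_ hB)) (vord_anti s ?_ hC) <;>
    omega

/-! ### Removing further coefficients with the symmetry -/

/-- `V` is brought to `w` by a near-identity change of variables and a time rescaling with
constant term `1`. -/
def NearReducible (V w : FormalVectorField) : Prop :=
  ∃ (φ : Fin 2 → Series) (T : Series),
    IsNearIdentity φ ∧ constantCoeff T = 1 ∧ Transforms φ T V w

theorem NearReducible.refl (V : FormalVectorField) : NearReducible V V :=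
  ⟨X, 1, isNearIdentity_of_mem_vord (s := 0) le_rfl
    (by rw [sub_self]; exact Submodule.zero_mem _)
    (by classical rw [coeff_X, if_neg (by simp [Finsupp.single_left_inj])]), map_one _, by
      rw [transforms_iff]
      intro i
      rw [lieD_X, subst_self, one_mul, id]⟩

theorem NearReducible.trans {V w u : FormalVectorField} (h₁ : NearReducible V w)
    (h₂ : NearReducible w u) : NearReducible V u := by
  obtain ⟨φ, T, hφ, hT, h⟩ := h₁
  obtain ⟨ψ, S, hψ, hS, h'⟩ := h₂
  exact ⟨comp φ ψ, subst ψ T * S, isNearIdentity_comp hφ hψ, by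
    rw [map_mul, constantCoeff_subst_eq hψ.1, hT, hS, mul_one], transforms_comp hφ.1 hψ.1 h h'⟩

theorem exists_nearReducible_add {s p k M : ℕ} {V U : FormalVectorField}
    (hV : V - leadingField s ∈ vord s (s + p)) (hU : U ∈ tangent s k) (hk : 1 ≤ k)
    (hMp : M ≤ k + p) (hMk : M ≤ 2 * k) :
    ∃ w, NearReducible V w ∧ w - (V + U) ∈ vord s (s + M) := by
  obtain ⟨φ, T, w, hφ, -, hT, htr, hw⟩ := exists_transforms_add hV hU hk hMp hMk
  have := constantCoeff_eq_zero_of_mem_ord (by omega) hT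
  rw [map_sub, map_one, sub_eq_zero] at this
  exact ⟨w, ⟨φ, T, hφ, this, htr⟩, hw⟩

/-- The coefficients of indices `k (s + 1) + 2 s`, `k ≠ s`, and those of indices at most `2 s`
vanish. -/
def IsReduced (s : ℕ) (α : ℕ → ℝ) : Prop :=
  (∀ i ≤ 2 * s, α i = 0) ∧ ∀ K, K ≠ s → α (K * (s + 1) + 2 * s) = 0

/-- A field that lacks the term of index 2s + k up to a tangent field can be cleaned by undoing U
and renormalizing from degree k + 1. Lower coefficients are untouched and the zero persists. -/
theorem exists_cancel {s k : ℕ} (hk : 1 ≤ k) {α : ℕ → ℝ} (hα : IsReduced s α)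
    {w U : FormalVectorField} (hU : U ∈ tangent s k)
    (hw : w - (orbitalForm s α - α (2 * s + k) • xField (2 * s + k + 1) + U)
      ∈ vord s (s + k + 1)) :
    ∃ α', NearReducible w (orbitalForm s α') ∧ IsReduced s α' ∧
      (∀ i < 2 * s + k, α' i = α i) ∧ α' (2 * s + k) = 0 := by
  have hα0 : ∀ i < 2 * s + 1, α i = 0 := fun i hi => hα.1 i (by omega)
  have hwV : w - leadingField s ∈ vord s (s + 1) := by
    have h1 := Submodule.add_mem _ (vord_anti s (by omega) hw)
      (orbitalForm_sub_leadingField_mem_vord hα0)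
    have h2 : xField (2 * s + k + 1) ∈ vord s (s + 1) := xField_mem_vord (by omega)
    have h3 := Submodule.add_mem _ (Submodule.sub_mem _ h1
      (Submodule.smul_mem _ (α (2 * s + k)) h2)) (vord_anti s (by omega) (tangent_le_vord s k hU))
    convert h3 using 1
    abel
  obtain ⟨w', hww', hw'⟩ := exists_nearReducible_add hwV (Submodule.neg_mem _ hU) hk
    (le_refl (k + 1)) (by omega)
  let α₀ : ℕ → ℝ := fun i => if i < 2 * s + k then α i else 0
  have hα₀ : ∀ i < 2 * s + k, α₀ i = α i := fun i hi => if_pos hi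
  have hα₀' : ∀ i, 2 * s + k ≤ i → α₀ i = 0 := fun i hi => if_neg (by omega)
  have hdiff : orbitalForm s (Function.update α (2 * s + k) 0) - orbitalForm s α₀ ∈
      vord s (s + (k + 1)) := by
    refine orbitalForm_sub_mem_vord fun i hi => ?_
    by_cases h : i = 2 * s + k
    · rw [h, Function.update_self, hα₀' _ le_rfl]
    · rw [Function.update_of_ne h, hα₀ i (by omega)]
  rw [orbitalForm_update, zero_sub, neg_smul] at hdiff
  obtain ⟨φ, T, α', hφ, hT, htr, heq, hres⟩ := exists_transforms_orbitalForm (s := s)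
    (k₀ := k + 1) (V := w') (α₀ := α₀) (by omega)
    (fun i hi => by rw [hα₀ i (by omega), hα.1 i hi]) (fun i hi => hα₀' i (by omega)) (by
      have := Submodule.add_mem _ (Submodule.add_mem _ hw' hw) hdiff
      convert this using 1
      abel)
  have hlt : ∀ i < 2 * s + k, α' i = α i := fun i hi => by rw [heq i (by omega), hα₀ i hi]
  have hat : α' (2 * s + k) = 0 := by rw [heq _ (by omega), hα₀' _ le_rfl]
  refine ⟨α', hww'.trans ⟨φ, T, hφ, hT, htr⟩, ⟨fun i hi => ?_, fun K hK => ?_⟩, hlt, hat⟩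
  · rw [hlt i (by omega), hα.1 i hi]
  · rcases lt_trichotomy (K * (s + 1) + 2 * s) (2 * s + k) with h | h | h
    · rw [hlt _ h, hα.2 K hK]
    · rw [h, hat]
    · exact hres K hK (by omega)

theorem orbitalForm_flow {s q : ℕ} (hs : 1 ≤ s) (c : ℝ) {α : ℕ → ℝ}
    (hα : ∀ i < 2 * s + q, α i = 0) :
    ∃ w, NearReducible (orbitalForm s α) w ∧
      w - (orbitalForm s α + c • bracket (eulerField s 0) (orbitalForm s α - leadingField s))
        ∈ vord s (s + q + 2 * (s * (s + 1))) := by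
  have hW := orbitalForm_sub_leadingField_mem_vord (k := q) hα
  obtain ⟨φ, w, hφ, htr, hw⟩ := exists_flow hs c hW
  rw [add_sub_cancel] at htr hw
  exact ⟨w, ⟨φ, 1, hφ, map_one _, htr⟩, hw⟩

theorem orbitalForm_sub_leadingField_expand {s q : ℕ} {α : ℕ → ℝ}
    (hα : ∀ i < 2 * s + q, α i = 0) :
    orbitalForm s α - leadingField s - α (2 * s + q) • xField (2 * s + q + 1)
      ∈ vord s (s + (q + 1)) := by
  have h := orbitalForm_sub_mem_vord (s := s) (k := q + 1) (α := α)
    (β := Function.update 0 (2 * s + q) (α (2 * s + q))) fun i hi => by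
      by_cases h : i = 2 * s + q
      · rw [h, Function.update_self]
      · rw [Function.update_of_ne h, hα i (by omega), Pi.zero_apply]
  rw [orbitalForm_update, orbitalForm_zero, Pi.zero_apply, sub_zero] at h
  rwa [sub_sub]

theorem eulerField_mem_vord_self (s : ℕ) : eulerField s 0 ∈ vord s (s * (s + 1)) :=
  eulerField_mem_vord (by rw [mul_comm]; omega)

/-- The flow first changes the cokernel coefficient in relative degree q + s(s+1), by c ν α(2s+q)
with ν ≠ 0; c is solved from this linear equation. The second-order flow error lies strictly higher.
-/
theorem exists_cancel_first {s q : ℕ} (hs : 1 ≤ s) (hq : 1 ≤ q) {α : ℕ → ℝ}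
    (hα : IsReduced s α) (h0 : ∀ i < 2 * s + q, α i = 0) (hne : α (2 * s + q) ≠ 0) :
    ∃ α', NearReducible (orbitalForm s α) (orbitalForm s α') ∧ IsReduced s α' ∧
      (∀ i < 2 * s + (q + s * (s + 1)), α' i = α i) ∧ α' (2 * s + (q + s * (s + 1))) = 0 := by
  have hκ : 1 ≤ s * (s + 1) := Nat.mul_pos hs (Nat.succ_pos s)
  obtain ⟨ν, hν, hT⟩ := exists_bracket_eulerField_xField s hq
  set κ := s * (s + 1)
  let c : ℝ := -(α (2 * s + (q + κ)) / (α (2 * s + q) * ν))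
  obtain ⟨w, hVw, hw⟩ := orbitalForm_flow hs c h0
  have hexp := bracket_mem_vord (eulerField_mem_vord_self s)
    (orbitalForm_sub_leadingField_expand h0)
  have hU := Submodule.smul_mem _ (c * α (2 * s + q)) hT
  obtain ⟨α', hw', h⟩ := exists_cancel (w := w) (by omega) hα hU (by
    have := Submodule.add_mem _ (vord_anti s (by omega) hw)
      (Submodule.smul_mem _ c (vord_anti s (q := κ + (s + (q + 1))) (p := s + (q + κ) + 1)
        (by omega) hexp))
    convert this using 1
    rw [sub_eq_add_neg (orbitalForm s α - leadingField s), bracket_add_right, ← neg_smul,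
      bracket_smul_right]
    have hc : c * α (2 * s + q) * ν = -α (2 * s + (q + κ)) := by
      simp only [c]; field_simp
    match_scalars <;> first | ring1 | linear_combination hc)
  exact ⟨α', hVw.trans hw', h⟩

/-- Write κ = s(s+1). The flow acting on the term of relative degree κ produces a field of degree 2κ
= (s+1)(2s), which is tangent since 2s ≠ s. Undoing it costs errors of degree 3κ, harmless exactly
when q + κ < 3κ. The next term, of degree q, then determines c as before. -/
theorem exists_cancel_second {s q : ℕ} (hs : 1 ≤ s) {α : ℕ → ℝ} (hα : IsReduced s α)
    (h0 : ∀ i < 2 * s + q, i ≠ 2 * s + s * (s + 1) → α i = 0)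
    (hq : s * (s + 1) < q) (hq' : q < 2 * (s * (s + 1))) (hne : α (2 * s + q) ≠ 0) :
    ∃ α', NearReducible (orbitalForm s α) (orbitalForm s α') ∧ IsReduced s α' ∧
      (∀ i < 2 * s + (q + s * (s + 1)), α' i = α i) ∧ α' (2 * s + (q + s * (s + 1))) = 0 := by
  have hκ : 1 ≤ s * (s + 1) := Nat.mul_pos hs (Nat.succ_pos s)
  obtain ⟨ν, hν, hT⟩ := exists_bracket_eulerField_xField s (k := q) (by omega)
  obtain ⟨ν₁, -, hT₁⟩ := exists_bracket_eulerField_xField s hκ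
  have hbad := xField_mem_tangent (s := s) (K := 2 * s) (by omega) (by omega)
  have hE := eulerField_mem_vord_self s
  rw [show (s + 1) * (2 * s) = s * (s + 1) + s * (s + 1) by ring] at hbad
  set κ := s * (s + 1)
  set Y := eulerField s 0
  set V₀ := leadingField s
  have hT₁' : bracket Y (xField (2 * s + κ + 1)) ∈ tangent s (κ + κ) := by
    have := Submodule.add_mem _ hT₁ (Submodule.smul_mem _ ν₁ hbad)
    rwa [sub_add_cancel] at this
  let c : ℝ := -(α (2 * s + (q + κ)) / (α (2 * s + q) * ν))
  have h00 : ∀ i < 2 * s + κ, α i = 0 := fun i hi => h0 i (by omega) (by omega)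
  obtain ⟨w, hVw, hw⟩ := orbitalForm_flow hs c h00
  let β : ℕ → ℝ := Function.update α (2 * s + κ) 0
  have hβ : orbitalForm s β = orbitalForm s α - α (2 * s + κ) • xField (2 * s + κ + 1) := by
    rw [orbitalForm_update, zero_sub, neg_smul, sub_eq_add_neg]
  have hβ0 : ∀ i < 2 * s + q, β i = 0 := fun i hi => by
    by_cases h : i = 2 * s + κ
    · rw [h]; exact Function.update_self _ _ _
    · rw [show β i = α i from Function.update_of_ne h _ _, h0 i hi h]
  have hβq : β (2 * s + q) = α (2 * s + q) := Function.update_of_ne (by omega) _ _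
  have hexp := bracket_mem_vord hE (orbitalForm_sub_leadingField_expand hβ0)
  rw [hβq, hβ] at hexp
  have hWκ := orbitalForm_sub_leadingField_mem_vord (k := κ) h00
  have hwV : w - V₀ ∈ vord s (s + κ) := by
    have := Submodule.add_mem _ (Submodule.add_mem _ (vord_anti s (by omega) hw) hWκ)
      (Submodule.smul_mem _ c (vord_anti s (by omega) (bracket_mem_vord hE hWκ)))
    convert this using 1
    abel
  obtain ⟨w', hww', hw'⟩ := exists_nearReducible_add (M := 3 * κ) hwV
    (Submodule.smul_mem _ (-(c * α (2 * s + κ))) hT₁') (by omega) (by omega) (by omega)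
  have hU := Submodule.smul_mem _ (c * α (2 * s + q)) hT
  obtain ⟨α', hw'α, h⟩ := exists_cancel (w := w') (by omega) hα hU (by
    have := Submodule.add_mem _ (Submodule.add_mem _
      (vord_anti s (p := s + (q + κ) + 1) (by omega) hw')
      (vord_anti s (p := s + (q + κ) + 1) (by omega) hw))
      (Submodule.smul_mem _ c (vord_anti s (q := κ + (s + (q + 1))) (p := s + (q + κ) + 1)
        (by omega) hexp))
    convert this using 1
    rw [show orbitalForm s α - α (2 * s + κ) • xField (2 * s + κ + 1) - V₀
        - α (2 * s + q) • xField (2 * s + q + 1)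
      = (orbitalForm s α - V₀) + (-α (2 * s + κ)) • xField (2 * s + κ + 1)
        + (-α (2 * s + q)) • xField (2 * s + q + 1) by module,
      bracket_add_right, bracket_add_right, bracket_smul_right, bracket_smul_right]
    have hc : c * α (2 * s + q) * ν = -α (2 * s + (q + κ)) := by
      simp only [c]; field_simp
    match_scalars <;> first | ring1 | linear_combination hc)
  exact ⟨α', (hVw.trans hww').trans hw'α, h⟩

theorem exists_isLeast {P : ℕ → Prop} (h : ∃ n, P n) : ∃ n, IsLeast {i | P i} n := by
  classical
  exact ⟨Nat.find h, Nat.find_spec h, fun _ hi => Nat.find_min' h hi⟩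

/-- The further reduction of the orbital form that uses the symmetries of the leading part. -/
theorem exists_further_reduction {s : ℕ} (hs : 1 ≤ s) {α : ℕ → ℝ} (hα : IsReduced s α) :
    ∃ α', NearReducible (orbitalForm s α) (orbitalForm s α') ∧ IsReduced s α' ∧
      ∀ r₁, IsLeast {i | α' i ≠ 0} r₁ → α' (r₁ + s ^ 2 + s) = 0 ∧
        (r₁ = s * (s + 1) + 2 * s → ∀ r₂, IsLeast {i | r₁ < i ∧ α' i ≠ 0} r₂ →
          r₂ < 2 * s ^ 2 + 4 * s → α' (s + r₂ + s ^ 2) = 0) := by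
  have hκ : 1 ≤ s * (s + 1) := Nat.mul_pos hs (Nat.succ_pos s)
  have hsq : s ^ 2 + s = s * (s + 1) := by ring
  -- For r₁ = s(s+1) + 2s the index r₁ + s² + s is the one with K = 2s, already normalized.
  have hres : ∀ β : ℕ → ℝ, IsReduced s β →
      β (s * (s + 1) + 2 * s + s ^ 2 + s) = 0 := fun β hβ => by
    rw [show s * (s + 1) + 2 * s + s ^ 2 + s = 2 * s * (s + 1) + 2 * s by ring]
    exact hβ.2 (2 * s) (by omega)
  by_cases hex : ∃ i, α i ≠ 0
  swap
  · push Not at hex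
    exact ⟨α, .refl _, hα, fun r₁ hr₁ => absurd (hex r₁) hr₁.1⟩
  obtain ⟨r, hr⟩ := exists_isLeast hex
  have hr0 : ∀ i < r, α i = 0 := fun i hi => by
    by_contra h; exact absurd (hr.2 h) (by omega)
  have hrne : α r ≠ 0 := hr.1
  have hr2 : 2 * s < r := by
    by_contra h; exact hrne (hα.1 r (by omega))
  obtain ⟨q, rfl⟩ := Nat.exists_eq_add_of_lt hr2
  have hleast : ∀ α' : ℕ → ℝ, (∀ i ≤ 2 * s + q + 1, α' i = α i) → ∀ r₁,
      IsLeast {i | α' i ≠ 0} r₁ → r₁ = 2 * s + q + 1 := fun α' h r₁ hr₁ => by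
    refine hr₁.unique ⟨?_, fun i hi => ?_⟩
    · rw [Set.mem_ofPred_eq, h _ le_rfl]; exact hrne
    · by_contra hlt
      exact hi (by rw [h i (by omega), hr0 i (by omega)])
  by_cases hspec : 2 * s + q + 1 = s * (s + 1) + 2 * s
  · by_cases hex₂ : ∃ i, (2 * s + q + 1 < i ∧ α i ≠ 0) ∧ i < 2 * s ^ 2 + 4 * s
    swap
    · refine ⟨α, .refl _, hα, fun r₁ hr₁ => ?_⟩
      obtain rfl := hleast α (fun _ _ => rfl) r₁ hr₁
      refine ⟨by rw [hspec]; exact hres α hα, fun _ r₂ hr₂ hlt => ?_⟩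
      exact absurd ⟨r₂, hr₂.1, hlt⟩ hex₂
    · obtain ⟨r₂, hr₂⟩ := exists_isLeast (P := fun i => 2 * s + q + 1 < i ∧ α i ≠ 0)
        (hex₂.imp fun i hi => hi.1)
      obtain ⟨i, hi, hi'⟩ := hex₂
      have hr₂lt : r₂ < 2 * s ^ 2 + 4 * s := lt_of_le_of_lt (hr₂.2 hi) hi'
      have hr₂gt : 2 * s + q + 1 < r₂ := hr₂.1.1
      have hr₂ne : α r₂ ≠ 0 := hr₂.1.2
      obtain ⟨q', rfl⟩ := Nat.exists_eq_add_of_le (show 2 * s ≤ r₂ by omega)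
      -- After the shift by 2s, the bound on r₂ is exactly q' < 2s(s+1).
      have hlt₂ : 2 * s ^ 2 + 4 * s = 2 * (s * (s + 1)) + 2 * s := by ring
      obtain ⟨α', hred, hα', heq, hN⟩ := exists_cancel_second (q := q') hs hα
        (fun i hi hne => by
          rcases lt_or_ge (2 * s + q + 1) i with h | h
          · by_contra h0
            have : 2 * s + q' ≤ i := hr₂.2 ⟨h, h0⟩
            omega
          · exact hr0 i (by omega)) (by omega) (by omega) hr₂ne
      refine ⟨α', hred, hα', fun r₁ hr₁ => ?_⟩
      obtain rfl := hleast α' (fun i hi => heq i (by omega)) r₁ hr₁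
      refine ⟨by rw [hspec]; exact hres α' hα', fun _ r₂' hr₂' _ => ?_⟩
      have : r₂' = 2 * s + q' := by
        refine hr₂'.unique ⟨⟨hr₂gt, ?_⟩, fun j hj => ?_⟩
        · rw [heq _ (by omega)]; exact hr₂ne
        · by_contra hlt
          exact hlt (hr₂.2 ⟨hj.1, by rw [← heq j (by omega)]; exact hj.2⟩)
      rw [this, show s + (2 * s + q') + s ^ 2 = 2 * s + (q' + s * (s + 1)) by ring]
      exact hN
  · obtain ⟨α', hred, hα', heq, hN⟩ := exists_cancel_first (q := q + 1) hs (by omega) hα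
      hr0 hrne
    refine ⟨α', hred, hα', fun r₁ hr₁ => ?_⟩
    obtain rfl := hleast α' (fun i hi => heq i (by omega)) r₁ hr₁
    refine ⟨?_, fun h => absurd h hspec⟩
    rw [show 2 * s + q + 1 + s ^ 2 + s = 2 * s + (q + 1 + s * (s + 1)) by ring]
    exact hN

/-! ### Scaling to b_s = 1 and the entry into weighted degrees -/

theorem seriesInY_smul (r : ℝ) (c : ℕ → ℝ) : seriesInY (r • c) = r • seriesInY c := by
  ext d
  simp only [map_smul, coeff_seriesInY, Pi.smul_apply, smul_eq_mul]
  split_ifs <;> simp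

/-- The scaling `(x, y) ↦ (β x, y)`. -/
noncomputable def scaling (β : ℝ) : Fin 2 → Series := (![β, 1] : Fin 2 → ℝ) • X

theorem scaling_zero (β : ℝ) : scaling β 0 = β • X 0 := rfl

theorem scaling_one (β : ℝ) : scaling β 1 = X 1 := one_smul ℝ _

theorem linearPart_scaling (β : ℝ) : linearPart (scaling β) = !![β, 0; 0, 1] := by
  ext i j
  rw [linearPart_apply]
  fin_cases i <;> fin_cases j <;>
    simp [scaling_zero, scaling_one, smul_eq_C_mul, pderiv_X_of_ne]

theorem constantCoeff_scaling (β : ℝ) (i : Fin 2) : constantCoeff (scaling β i) = 0 := by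
  fin_cases i <;> simp [scaling_zero, scaling_one, smul_eq_C_mul]

theorem isStateChange_scaling {β : ℝ} (hβ : β ≠ 0) : IsStateChange (scaling β) :=
  ⟨constantCoeff_scaling β, by rw [linearPart_scaling]; simpa using hβ⟩

theorem isNearIdentity_scaling_one : IsNearIdentity (scaling 1) :=
  ⟨constantCoeff_scaling 1, by rw [linearPart_scaling, Matrix.one_fin_two]⟩

theorem subst_scaling_seriesInY (β : ℝ) (c : ℕ → ℝ) :
    subst (scaling β) (seriesInY c) = seriesInY c := by
  rw [scaling, ← rescale_eq_subst]
  ext d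
  rw [coeff_rescale, coeff_seriesInY]
  split_ifs with h
  · rw [Finsupp.prod_fintype _ _ fun i => pow_zero _]
    simp [h]
  · rw [mul_zero]

/-- Putting x = βX turns -x into -βX, and the time factor 1/β restores it. This divides b by β and a
by β², so β = b_s normalizes the leading coefficient. -/
theorem transforms_scaling {β : ℝ} (hβ : β ≠ 0) (a b : ℕ → ℝ) :
    Transforms (scaling β) (C β⁻¹) (classicalForm a b)
      (classicalForm ((β⁻¹ ^ 2) • a) (β⁻¹ • b)) := by
  have hs := hasSubst_of_zero (constantCoeff_scaling β)
  have hC : C β⁻¹ * C β = (1 : Series) := by rw [← map_mul, inv_mul_cancel₀ hβ, map_one]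
  rw [transforms_iff]
  intro i
  fin_cases i
  · simp only [Fin.zero_eta, classicalForm, Matrix.cons_val_zero]
    rw [scaling_zero, Derivation.map_smul, lieD_X, subst_add hs, subst_mul hs, subst_mul hs,
      subst_X hs, subst_X hs, subst_scaling_seriesInY, subst_scaling_seriesInY, scaling_zero,
      scaling_one]
    simp only [Matrix.cons_val_zero, seriesInY_smul, smul_eq_C_mul, map_pow]
    linear_combination (X 1 * C β⁻¹ * seriesInY a) * hC
  · simp only [Fin.mk_one, classicalForm, Matrix.cons_val_one, Matrix.cons_val_zero]
    rw [scaling_one, lieD_X, subst_add hs, subst_mul hs, ← coe_substAlgHom hs, map_neg,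
      coe_substAlgHom hs, subst_X hs, subst_X hs, subst_scaling_seriesInY, scaling_zero,
      scaling_one]
    simp only [Matrix.cons_val_one, Matrix.cons_val_zero, seriesInY_smul, smul_eq_C_mul]
    linear_combination (X 0) * hC

/-- The inequality 2s < ρ enters here: y^(i+1) ∂/∂x has weighted degree i - s, which exceeds s
exactly when i > 2s. -/
theorem classicalForm_sub_leadingField_mem_vord {s : ℕ} {a b : ℕ → ℝ}
    (ha : ∀ k ≤ 2 * s, a k = 0) (hb : ∀ k < s, b k = 0) (hbs : b s = 1) :
    classicalForm a b - leadingField s ∈ vord s (s + 1) := by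
  have hA : seriesInY a ∈ ord s (2 * s + 1) :=
    seriesInY_mem_ord fun i hi => ha i (by omega)
  have hB : seriesInY b - X 1 ^ s ∈ ord s (s + 1) := by
    have h : seriesInY (b - Pi.single s 1) ∈ ord s (s + 1) := seriesInY_mem_ord fun i hi => by
      by_cases h : i = s
      · rw [h, Pi.sub_apply, hbs, Pi.single_eq_same, sub_self]
      · rw [Pi.sub_apply, hb i (by omega), Pi.single_eq_of_ne h, sub_self]
    rwa [seriesInY_sub, seriesInY_single, one_smul] at h
  refine ⟨?_, ?_⟩
  · have e : (classicalForm a b - leadingField s) 0 =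
        X 1 * seriesInY a + X 0 * (seriesInY b - X 1 ^ s) := by
      simp [classicalForm, leadingField]; ring
    rw [e]
    exact Ideal.add_mem _ (ord_anti s (by omega) (mul_mem_ord (X_one_mem_ord s) hA))
      (ord_anti s (by omega) (mul_mem_ord (X_zero_mem_ord s) hB))
  · have e : (classicalForm a b - leadingField s) 1 = X 1 * (seriesInY b - X 1 ^ s) := by
      simp [classicalForm, leadingField]; ring
    rw [e]
    exact ord_anti s (by omega) (mul_mem_ord (X_one_mem_ord s) hB)

/-- Orbital normal form of a generalized saddle-node in classical normal form with `b s = 1`. -/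
theorem exists_reduced_orbitalForm {s : ℕ} (hs : 1 ≤ s) {V : FormalVectorField}
    (hV : V - leadingField s ∈ vord s (s + 1)) :
    ∃ α, NearReducible V (orbitalForm s α) ∧ IsReduced s α ∧
      ∀ r₁, IsLeast {i | α i ≠ 0} r₁ → α (r₁ + s ^ 2 + s) = 0 ∧
        (r₁ = s * (s + 1) + 2 * s → ∀ r₂, IsLeast {i | r₁ < i ∧ α i ≠ 0} r₂ →
          r₂ < 2 * s ^ 2 + 4 * s → α (s + r₂ + s ^ 2) = 0) := by
  rw [← orbitalForm_zero] at hV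
  obtain ⟨φ, T, α, hφ, hT, htr, heq, hres⟩ := exists_transforms_orbitalForm le_rfl
    (fun _ _ => rfl) (fun _ _ => rfl) hV
  have hα : IsReduced s α := by
    refine ⟨fun i hi => heq i (by omega), fun K hK => ?_⟩
    rcases Nat.eq_zero_or_pos K with h | h
    · rw [h]; exact heq _ (by omega)
    · refine hres K hK ?_
      have : 1 * (s + 1) ≤ K * (s + 1) := Nat.mul_le_mul_right _ h
      omega
  obtain ⟨α', hred, h⟩ := exists_further_reduction hs hα
  exact ⟨α', .trans ⟨φ, T, hφ, hT, htr⟩ hred, h⟩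

end BogdanovTakens

open BogdanovTakens

theorem mainTheorem2
    (v : FormalVectorField) (hv : IsBogdanovTakens v)
    (φ₀ : Fin 2 → Series) (a b : ℕ → ℝ) (hφ₀ : IsClassicalReduction v φ₀ a b)
    (s ρ : ℕ) (hρ : IsLeast {k | a k ≠ 0} ρ) (hs : IsLeast {k | b k ≠ 0} s)
    (hsρ : 2 * s < ρ) :
    ∃ (φ : Fin 2 → Series) (T : Series) (α : ℕ → ℝ),
      IsStateChange φ ∧ constantCoeff T ≠ 0 ∧
      (IsNearIdentity φ₀ → b s = 1 → IsNearIdentity φ ∧ constantCoeff T = 1) ∧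
      Transforms φ T v (orbitalForm s α) ∧
      (∀ i, i ≤ 2 * s → α i = 0) ∧
      (∀ k, k ≠ s → α (k * (s + 1) + 2 * s) = 0) ∧
      (∀ r₁, IsLeast {i | α i ≠ 0} r₁ →
        α (r₁ + s ^ 2 + s) = 0 ∧
        (∀ k, k ≠ s → r₁ ≠ k * (s + 1) + 2 * s) ∧
        (r₁ = s * (s + 1) + 2 * s →
          ∀ r₂, IsLeast {i | r₁ < i ∧ α i ≠ 0} r₂ → r₂ < 2 * s ^ 2 + 4 * s →
            α (s + r₂ + s ^ 2) = 0)) := by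
  obtain ⟨hφ₀, -, hb0, htr₀⟩ := hφ₀
  have hbs : b s ≠ 0 := hs.1
  have hs1 : 1 ≤ s := by
    rcases Nat.eq_zero_or_pos s with h | h
    · rw [h] at hbs; exact absurd hb0 hbs
    · exact h
  have ha : ∀ k ≤ 2 * s, ((b s)⁻¹ ^ 2 • a) k = 0 := fun k hk => by
    have : a k = 0 := by by_contra h; exact absurd (hρ.2 h) (by omega)
    rw [Pi.smul_apply, this, smul_zero]
  have hb : ∀ k < s, ((b s)⁻¹ • b) k = 0 := fun k hk => by
    have : b k = 0 := by by_contra h; exact absurd (hs.2 h) (by omega)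
    rw [Pi.smul_apply, this, smul_zero]
  obtain ⟨α, ⟨ψ, S, hψ, hS, htr⟩, hα, hfin⟩ := exists_reduced_orbitalForm hs1
    (classicalForm_sub_leadingField_mem_vord ha hb (by
      rw [Pi.smul_apply, smul_eq_mul, inv_mul_cancel₀ hbs]))
  have hσ := isStateChange_scaling hbs
  have h1 := transforms_comp hφ₀.1 hσ.1 htr₀ (transforms_scaling hbs a b)
  have hφσ := isStateChange_comp hφ₀ hσ
  have h2 := transforms_comp hφσ.1 hψ.1 h1 htr
  have hT : constantCoeff (subst ψ (subst (scaling (b s)) (1 : Series) * C (b s)⁻¹) * S) =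
      (b s)⁻¹ := by
    rw [map_mul, constantCoeff_subst_eq hψ.1, map_mul, constantCoeff_subst_eq hσ.1, hS, map_one,
      constantCoeff_C, one_mul, mul_one]
  refine ⟨_, _, α, isStateChange_comp hφσ (isStateChange_of_isNearIdentity hψ), ?_, ?_, h2,
    hα.1, hα.2, fun r₁ hr₁ => ⟨(hfin r₁ hr₁).1, fun k hk hr => ?_, (hfin r₁ hr₁).2⟩⟩
  · rw [hT]; exact inv_ne_zero hbs
  · intro hnear hb1
    rw [hT, hb1, inv_one]
    exact ⟨isNearIdentity_comp (isNearIdentity_comp hnear isNearIdentity_scaling_one) hψ, rfl⟩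
  · exact hr₁.1 (by rw [hr]; exact hα.2 k hk)
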